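/- Let $k$ be an algebraically closed field and let $A=\bigoplus_{i\ge 0}A_i$ be a finite-dimensional positively graded $k$-algebra which is $1$-Gorenstein, i.e. $\operatorname{id}({}_AA)\le 1$ and $\operatorname{id}(A_A)\le 1$, and suppose that $\operatorname{gl.dim}A_0<\infty$. Let $\operatorname{mod}^{\mathbb Z}A$ be the abelian category of finitely generated $\mathbb Z$-graded left $A$-modules with degree-preserving $A$-linear maps, let $\operatorname{proj}^{\mathbb Z}A$ be its full subcategory of projective objects, and let $$D_{sg}(\operatorname{mod}^{\mathbb Z}A)=D^b(\operatorname{mod}^{\mathbb Z}A)/K^b(\operatorname{proj}^{\mathbb Z}A)$$ be the graded singularity category (a Verdier quotient), with shift functor $[1]$. For $X\in\operatorname{mod}^{\mathbb Z}A$ and $i\in\mathbb Z$ let $X(i)$ be the shifted module with $X(i)_j=X_{i+j}$, and let $X_{\le 0}=X/\bigoplus_{j\ge 1}X_j$. Then the object $$T=\bigoplus_{i\ge 0}A(i)_{\le 0}$$ of $D_{sg}(\operatorname{mod}^{\mathbb Z}A)$ (the coproduct in $D_{sg}(\operatorname{mod}^{\mathbb Z}A)$ of the stalk complexes $A(i)_{\le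 0}$, $i\ge 0$; it exists, all but finitely many of them being zero there) is a silting object: $\operatorname{Hom}(T,T[m])=0$ for all $m>0$, and the smallest triangulated subcategory of $D_{sg}(\operatorname{mod}^{\mathbb Z}A)$ that contains $T$ and is closed under direct summands is $D_{sg}(\operatorname{mod}^{\mathbb Z}A)$ itself. In particular $D_{sg}(\operatorname{mod}^{\mathbb Z}A)$ admits a silting object. -/

import Mathlib

open CategoryTheory CategoryTheory.Limits

universe u

/-! ## Internal gradings of abelian groups by `ℤ` -/

namespace IntGrading

variable {M : Type*} [AddCommGroup M]

/-- The projection of `M = ⨁ i, p i` onto the summand `p i`, as an additive endomorphism of `M`. -/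
noncomputable def comp {p : ℤ → AddSubgroup M} (h : DirectSum.IsInternal p) (i : ℤ) : M →+ M :=
  letI := h.chooseDecomposition
  (AddSubgroup.subtype (p i)).comp
    ((DFinsupp.evalAddMonoidHom i).comp (DirectSum.decomposeAddEquiv p).toAddMonoidHom)

theorem comp_mem {p : ℤ → AddSubgroup M} (h : DirectSum.IsInternal p) (i : ℤ) (x : M) :
    comp h i x ∈ p i :=
  SetLike.coe_mem _

theorem comp_same {p : ℤ → AddSubgroup M} (h : DirectSum.IsInternal p) {i : ℤ} {x : M}
    (hx : x ∈ p i) : comp h i x = x :=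
  letI := h.chooseDecomposition
  DirectSum.decompose_of_mem_same p hx

theorem comp_ne {p : ℤ → AddSubgroup M} (h : DirectSum.IsInternal p) {i j : ℤ} {x : M}
    (hx : x ∈ p i) (hij : i ≠ j) : comp h j x = 0 :=
  letI := h.chooseDecomposition
  DirectSum.decompose_of_mem_ne p hx hij

theorem exists_sum {p : ℤ → AddSubgroup M} (h : DirectSum.IsInternal p) (x : M) :
    ∃ s : Finset ℤ, ∑ i ∈ s, comp h i x = x := by
  classical
  let := h.chooseDecomposition
  exact ⟨_, DirectSum.sum_support_decompose p x⟩

theorem isInternal_of_comp {p : ℤ → AddSubgroup M} (c : ℤ → M →+ M)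
    (h₁ : ∀ i, ∀ x ∈ p i, c i x = x) (h₂ : ∀ i j, i ≠ j → ∀ x ∈ p i, c j x = 0)
    (h₃ : ∀ x, x ∈ ⨆ i, p i) : DirectSum.IsInternal p := by
  constructor
  · have key : ∀ (j : ℤ) (y : DirectSum ℤ fun i => p i),
        c j (DirectSum.coeAddMonoidHom p y) = (y j : M) := by
      intro j y
      induction y using DirectSum.induction_on with
      | zero => simp
      | of i x =>
        rw [DirectSum.coeAddMonoidHom_of, DirectSum.coe_of_apply]
        split_ifs with hij
        · subst hij; exact h₁ _ _ x.2
        · simpa using h₂ _ _ hij _ x.2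
      | add a b ha hb => simp [ha, hb]
    intro y z hyz
    ext j
    rw [← key j y, ← key j z, hyz]
  · intro x
    have hle : (⨆ i, p i) ≤ (DirectSum.coeAddMonoidHom p).range := by
      refine iSup_le fun i x hx => ⟨DirectSum.of (fun i => p i) i ⟨x, hx⟩, ?_⟩
      rw [DirectSum.coeAddMonoidHom_of]
    exact hle (h₃ x)

end IntGrading

/-! ## The category `mod^ℤ A` -/

/-- A finitely generated `ℤ`-graded left module over a `ℤ`-graded algebra `A = ⨁ i, 𝒜 i`:
a finitely generated left `A`-module `X` which is the internal direct sum of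
additive subgroups `X i`, `i ∈ ℤ`, such that `𝒜 i • X j ⊆ X (i + j)`.
The `X i` are then `k`-subspaces, as `k` acts through `𝒜 0`. -/
structure GrMod {k A : Type u} [Field k] [Ring A] [Algebra k A] (𝒜 : ℤ → Submodule k A) where
  carrier : Type u
  [addCommGroup : AddCommGroup carrier]
  [module : Module A carrier]
  [finite : Module.Finite A carrier]
  /-- the homogeneous component of degree `i` -/
  deg : ℤ → AddSubgroup carrier
  isInternal : DirectSum.IsInternal deg
  [gradedSMul : SetLike.GradedSMul 𝒜 deg]

namespace GrMod

variable {k A : Type u} [Field k] [Ring A] [Algebra k A] {𝒜 : ℤ → Submodule k A}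

instance : CoeSort (GrMod 𝒜) (Type u) := ⟨GrMod.carrier⟩

attribute [instance] addCommGroup module finite gradedSMul

/-- A morphism of graded modules: an `A`-linear map `f` with `f (X i) ⊆ Y i` for all `i`. -/
@[ext]
structure Hom (X Y : GrMod 𝒜) where
  toLin : X →ₗ[A] Y
  map_deg : ∀ i, ∀ x ∈ X.deg i, toLin x ∈ Y.deg i

instance : Category (GrMod 𝒜) where
  Hom X Y := Hom X Y
  id X := ⟨LinearMap.id, fun _ _ hx => hx⟩
  comp f g := ⟨g.toLin ∘ₗ f.toLin, fun i x hx => g.map_deg i _ (f.map_deg i x hx)⟩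

/-- The underlying linear map of a morphism. -/
def lin {X Y : GrMod 𝒜} (f : X ⟶ Y) : X →ₗ[A] Y := Hom.toLin f

theorem lin_map {X Y : GrMod 𝒜} (f : X ⟶ Y) {i : ℤ} {x : X} (hx : x ∈ X.deg i) :
    lin f x ∈ Y.deg i := Hom.map_deg f i x hx

/-- A morphism from a linear map which preserves degrees. -/
def mkHom {X Y : GrMod 𝒜} (f : X →ₗ[A] Y) (hf : ∀ i, ∀ x ∈ X.deg i, f x ∈ Y.deg i) : X ⟶ Y :=
  (⟨f, hf⟩ : Hom X Y)

@[simp] theorem lin_mkHom {X Y : GrMod 𝒜} (f : X →ₗ[A] Y) (hf) : lin (mkHom f hf) = f := rfl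

@[simp] theorem lin_id (X : GrMod 𝒜) : lin (𝟙 X) = LinearMap.id := rfl

@[simp] theorem lin_comp {X Y Z : GrMod 𝒜} (f : X ⟶ Y) (g : Y ⟶ Z) :
    lin (f ≫ g) = lin g ∘ₗ lin f := rfl

@[ext] theorem hom_ext {X Y : GrMod 𝒜} {f g : X ⟶ Y} (h : lin f = lin g) : f = g :=
  Hom.ext h

instance {X Y : GrMod 𝒜} : Zero (X ⟶ Y) := ⟨mkHom 0 fun i _ _ => (Y.deg i).zero_mem⟩
instance {X Y : GrMod 𝒜} : Add (X ⟶ Y) :=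
  ⟨fun f g => mkHom (lin f + lin g) fun i _ hx =>
    (Y.deg i).add_mem (lin_map f hx) (lin_map g hx)⟩
instance {X Y : GrMod 𝒜} : Neg (X ⟶ Y) :=
  ⟨fun f => mkHom (-lin f) fun i _ hx => (Y.deg i).neg_mem (lin_map f hx)⟩
instance {X Y : GrMod 𝒜} : Sub (X ⟶ Y) :=
  ⟨fun f g => mkHom (lin f - lin g) fun i _ hx =>
    (Y.deg i).sub_mem (lin_map f hx) (lin_map g hx)⟩
instance {X Y : GrMod 𝒜} : SMul ℕ (X ⟶ Y) :=
  ⟨fun n f => mkHom (n • lin f) fun i _ hx => (Y.deg i).nsmul_mem (lin_map f hx) n⟩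
instance {X Y : GrMod 𝒜} : SMul ℤ (X ⟶ Y) :=
  ⟨fun n f => mkHom (n • lin f) fun i _ hx => (Y.deg i).zsmul_mem (lin_map f hx) n⟩

@[simp] theorem lin_zero {X Y : GrMod 𝒜} : lin (0 : X ⟶ Y) = 0 := rfl
@[simp] theorem lin_add {X Y : GrMod 𝒜} (f g : X ⟶ Y) : lin (f + g) = lin f + lin g := rfl

instance {X Y : GrMod 𝒜} : AddCommGroup (X ⟶ Y) :=
  Function.Injective.addCommGroup (lin : (X ⟶ Y) → (X →ₗ[A] Y)) (fun _ _ h => hom_ext h)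
    rfl (fun _ _ => rfl) (fun _ => rfl) (fun _ _ => rfl) (fun _ _ => rfl) (fun _ _ => rfl)

instance : Preadditive (GrMod 𝒜) where
  add_comp _ _ _ f g h := by ext x; simp
  comp_add _ _ _ f g h := by ext x; simp

/-- The component of degree `i` of an element of a graded module. -/
noncomputable def comp (X : GrMod 𝒜) (i : ℤ) : X →+ X := IntGrading.comp X.isInternal i

theorem comp_mem (X : GrMod 𝒜) (i : ℤ) (x : X) : X.comp i x ∈ X.deg i :=
  IntGrading.comp_mem _ _ _

theorem comp_same (X : GrMod 𝒜) {i : ℤ} {x : X} (hx : x ∈ X.deg i) : X.comp i x = x :=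
  IntGrading.comp_same _ hx

theorem comp_ne (X : GrMod 𝒜) {i j : ℤ} {x : X} (hx : x ∈ X.deg i) (hij : i ≠ j) :
    X.comp j x = 0 :=
  IntGrading.comp_ne _ hx hij

theorem exists_sum (X : GrMod 𝒜) (x : X) : ∃ s : Finset ℤ, ∑ i ∈ s, X.comp i x = x :=
  IntGrading.exists_sum _ x

theorem lin_comp_apply {X Y : GrMod 𝒜} (f : X ⟶ Y) (i : ℤ) (x : X) :
    lin f (X.comp i x) = Y.comp i (lin f x) := by
  obtain ⟨s, hs⟩ := X.exists_sum x
  have key : ∀ j, lin f (X.comp i (X.comp j x)) = Y.comp i (lin f (X.comp j x)) := by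
    intro j
    by_cases hij : j = i
    · subst hij
      rw [X.comp_same (X.comp_mem _ _), Y.comp_same (lin_map f (X.comp_mem _ _))]
    · rw [X.comp_ne (X.comp_mem _ _) hij, Y.comp_ne (lin_map f (X.comp_mem _ _)) hij, map_zero]
  conv_lhs => rw [← hs]
  conv_rhs => rw [← hs]
  simp only [map_sum, key]

/-- A submodule is homogeneous if it contains the components of its elements. -/
def IsHomog (X : GrMod 𝒜) (S : Submodule A X) : Prop := ∀ x ∈ S, ∀ i, X.comp i x ∈ S

theorem ker_isHomog {X Y : GrMod 𝒜} (f : X ⟶ Y) : X.IsHomog (LinearMap.ker (lin f)) := by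
  intro x hx i
  rw [LinearMap.mem_ker] at hx ⊢
  rw [lin_comp_apply, hx, map_zero]

theorem range_isHomog {X Y : GrMod 𝒜} (f : X ⟶ Y) : Y.IsHomog (LinearMap.range (lin f)) := by
  rintro _ ⟨x, rfl⟩ i
  exact ⟨X.comp i x, lin_comp_apply f i x⟩

/-- A homogeneous submodule `S` of `X`, as a graded module, with `S i = S ∩ X i`. -/
def sub [Module.Finite k A] (X : GrMod 𝒜) (S : Submodule A X) (hS : X.IsHomog S) : GrMod 𝒜 where
  carrier := S
  finite :=
    have := IsNoetherianRing.of_finite k A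
    inferInstance
  deg i := (X.deg i).comap S.subtype.toAddMonoidHom
  isInternal := by
    refine IntGrading.isInternal_of_comp
      (fun i => ((X.comp i).comp S.subtype.toAddMonoidHom).codRestrict S.toAddSubgroup
        fun x => hS _ x.2 i) ?_ ?_ ?_
    · intro i x hx
      exact Subtype.ext (X.comp_same hx)
    · intro i j hij x hx
      exact Subtype.ext (X.comp_ne hx hij)
    · intro x
      obtain ⟨s, hs⟩ := X.exists_sum (x : X)
      have : x = ∑ i ∈ s, (⟨X.comp i x, hS _ x.2 i⟩ : S) := by
        apply Subtype.ext
        rw [AddSubmonoidClass.coe_finsetSum]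
        exact hs.symm
      rw [this]
      refine sum_mem fun i _ => AddSubgroup.mem_iSup_of_mem i ?_
      exact X.comp_mem i x
  gradedSMul := ⟨fun _ _ _ _ ha hx => SetLike.GradedSMul.smul_mem (A := 𝒜) (B := X.deg) ha hx⟩

/-- The factor module of `X` by a homogeneous submodule `S`, as a graded module, with
`(X / S) i` the image of `X i`. -/
def quot (X : GrMod 𝒜) (S : Submodule A X) (hS : X.IsHomog S) : GrMod 𝒜 where
  carrier := X ⧸ S
  deg i := (X.deg i).map S.mkQ.toAddMonoidHom
  isInternal := by
    refine IntGrading.isInternal_of_comp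
      (fun i => QuotientAddGroup.map S.toAddSubgroup S.toAddSubgroup (X.comp i)
        fun x hx => hS x hx i) ?_ ?_ ?_
    · rintro i _ ⟨x, hx, rfl⟩
      exact congrArg S.mkQ (X.comp_same hx)
    · rintro i j hij _ ⟨x, hx, rfl⟩
      exact (congrArg S.mkQ (X.comp_ne hx hij)).trans (map_zero _)
    · intro y
      obtain ⟨x, rfl⟩ := S.mkQ_surjective y
      obtain ⟨s, hs⟩ := X.exists_sum x
      rw [← hs, map_sum]
      exact sum_mem fun i _ => AddSubgroup.mem_iSup_of_mem i ⟨_, X.comp_mem i x, rfl⟩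
  gradedSMul := ⟨by
    rintro i j a _ ha ⟨x, hx, rfl⟩
    exact ⟨a • x, SetLike.GradedSMul.smul_mem (A := 𝒜) (B := X.deg) ha hx, S.mkQ.map_smul a x⟩⟩

/-- The direct sum of two graded modules. -/
def prod (X Y : GrMod 𝒜) : GrMod 𝒜 where
  carrier := X × Y
  deg i := (X.deg i).prod (Y.deg i)
  isInternal := by
    refine IntGrading.isInternal_of_comp (fun i => (X.comp i).prodMap (Y.comp i)) ?_ ?_ ?_
    · rintro i ⟨x, y⟩ ⟨hx, hy⟩
      exact Prod.ext (X.comp_same hx) (Y.comp_same hy)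
    · rintro i j hij ⟨x, y⟩ ⟨hx, hy⟩
      exact Prod.ext (X.comp_ne hx hij) (Y.comp_ne hy hij)
    · rintro ⟨x, y⟩
      obtain ⟨s, hs⟩ := X.exists_sum x
      obtain ⟨t, ht⟩ := Y.exists_sum y
      have : ((x, y) : X × Y) =
          ∑ i ∈ s, ((X.comp i x, 0) : X × Y) + ∑ i ∈ t, ((0, Y.comp i y) : X × Y) := by
        apply Prod.ext
        · simp [Prod.fst_sum, hs]
        · simp [Prod.snd_sum, ht]
      rw [this]
      exact add_mem
        (sum_mem fun i _ => AddSubgroup.mem_iSup_of_mem i ⟨X.comp_mem i x, zero_mem _⟩)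
        (sum_mem fun i _ => AddSubgroup.mem_iSup_of_mem i ⟨zero_mem _, Y.comp_mem i y⟩)
  gradedSMul := ⟨fun _ _ _ _ ha hx =>
    ⟨SetLike.GradedSMul.smul_mem (A := 𝒜) (B := X.deg) ha hx.1,
      SetLike.GradedSMul.smul_mem (A := 𝒜) (B := Y.deg) ha hx.2⟩⟩

/-- The zero graded module. -/
def zero (𝒜 : ℤ → Submodule k A) : GrMod 𝒜 where
  carrier := PUnit
  deg _ := ⊤
  isInternal := IntGrading.isInternal_of_comp (fun _ => 0) (fun _ _ _ => rfl)
    (fun _ _ _ _ _ => rfl) (fun _ => AddSubgroup.mem_iSup_of_mem 0 trivial)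
  gradedSMul := ⟨fun _ _ _ _ _ _ => trivial⟩

theorem zero_isZero : IsZero (zero 𝒜) := by
  rw [IsZero.iff_id_eq_zero]
  exact hom_ext (LinearMap.ext fun _ => rfl)

instance : HasZeroObject (GrMod 𝒜) := ⟨⟨zero 𝒜, zero_isZero⟩⟩

instance : HasBinaryBiproducts (GrMod 𝒜) where
  has_binary_biproduct X Y := HasBinaryBiproduct.mk
    { bicone :=
        { pt := prod X Y
          fst := mkHom (LinearMap.fst A X Y) fun _ _ h => h.1
          snd := mkHom (LinearMap.snd A X Y) fun _ _ h => h.2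
          inl := mkHom (LinearMap.inl A X Y) fun _ _ h => ⟨h, zero_mem _⟩
          inr := mkHom (LinearMap.inr A X Y) fun _ _ h => ⟨zero_mem _, h⟩
          inl_fst := rfl
          inl_snd := rfl
          inr_fst := rfl
          inr_snd := rfl }
      isBilimit := isBinaryBilimitOfTotal _ (by
        refine hom_ext (LinearMap.ext fun x => ?_)
        exact Prod.ext (add_zero x.1) (zero_add x.2)) }

instance : HasFiniteProducts (GrMod 𝒜) :=
  have : HasTerminal (GrMod 𝒜) := HasZeroObject.hasTerminal
  hasFiniteProducts_of_has_binary_and_terminal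

/-! ### Kernels and cokernels -/

/-- The inclusion of a homogeneous submodule. -/
def subι [Module.Finite k A] (X : GrMod 𝒜) (S : Submodule A X) (hS : X.IsHomog S) :
    X.sub S hS ⟶ X :=
  mkHom S.subtype fun _ _ h => h

/-- The projection onto the factor module by a homogeneous submodule. -/
def quotπ (X : GrMod 𝒜) (S : Submodule A X) (hS : X.IsHomog S) : X ⟶ X.quot S hS :=
  mkHom S.mkQ fun _ x h => ⟨x, h, rfl⟩

/-- Lifting a morphism through the inclusion of a homogeneous submodule. -/
def liftSub [Module.Finite k A] {X Y : GrMod 𝒜} (S : Submodule A X) (hS : X.IsHomog S)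
    (f : Y ⟶ X) (hf : ∀ y, lin f y ∈ S) : Y ⟶ X.sub S hS :=
  mkHom ((lin f).codRestrict S hf) fun _ _ h => lin_map f h

/-- Descending a morphism through the projection onto a factor module. -/
def descQuot {X Y : GrMod 𝒜} (S : Submodule A X) (hS : X.IsHomog S)
    (f : X ⟶ Y) (hf : S ≤ LinearMap.ker (lin f)) : X.quot S hS ⟶ Y :=
  mkHom (S.liftQ (lin f) hf) (by rintro i _ ⟨x, hx, rfl⟩; exact lin_map f hx)

theorem lin_apply_eq_zero {X Y Z : GrMod 𝒜} {f : X ⟶ Y} {g : Y ⟶ Z} (w : f ≫ g = 0) (x : X) :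
    lin g (lin f x) = 0 :=
  LinearMap.congr_fun (congrArg lin w) x

/-- The inclusion of `ker f` is a kernel of `f`. -/
def kerIsLimit [Module.Finite k A] {X Y : GrMod 𝒜} (f : X ⟶ Y) :
    IsLimit (KernelFork.ofι (f := f) (X.subι _ (ker_isHomog f))
      (hom_ext (LinearMap.ext fun x => x.2))) :=
  KernelFork.IsLimit.ofι _ _ (fun g w => liftSub _ _ g fun y => lin_apply_eq_zero w y)
    (fun _ _ => rfl)
    (fun _ _ _ hm => hom_ext (LinearMap.ext fun y => Subtype.ext
      (LinearMap.congr_fun (congrArg lin hm) y)))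

/-- The projection onto `Y / im f` is a cokernel of `f`. -/
def cokerIsColimit {X Y : GrMod 𝒜} (f : X ⟶ Y) :
    IsColimit (CokernelCofork.ofπ (f := f) (Y.quotπ _ (range_isHomog f))
      (hom_ext (LinearMap.ext fun x => (Submodule.Quotient.mk_eq_zero _).2 ⟨x, rfl⟩))) :=
  CokernelCofork.IsColimit.ofπ _ _
    (fun g w => descQuot _ _ g (by rintro _ ⟨x, rfl⟩; exact lin_apply_eq_zero w x))
    (fun _ _ => rfl)
    (fun g w m hm => hom_ext (LinearMap.ext fun y => by
      obtain ⟨y, rfl⟩ := Submodule.mkQ_surjective _ y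
      exact LinearMap.congr_fun (congrArg lin hm) y))

instance [Module.Finite k A] : HasKernels (GrMod 𝒜) where
  has_limit f := ⟨⟨⟨_, kerIsLimit f⟩⟩⟩

instance : HasCokernels (GrMod 𝒜) where
  has_colimit f := ⟨⟨⟨_, cokerIsColimit f⟩⟩⟩

theorem injective_of_mono [Module.Finite k A] {X Y : GrMod 𝒜} (f : X ⟶ Y) [Mono f] :
    Function.Injective (lin f) := by
  rw [← LinearMap.ker_eq_bot, eq_bot_iff]
  intro x hx
  have h : X.subι _ (ker_isHomog f) = 0 :=
    zero_of_comp_mono f (hom_ext (LinearMap.ext fun x => x.2))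
  exact LinearMap.congr_fun (congrArg lin h) ⟨x, hx⟩

theorem surjective_of_epi {X Y : GrMod 𝒜} (f : X ⟶ Y) [Epi f] :
    Function.Surjective (lin f) := by
  rw [← LinearMap.range_eq_top, eq_top_iff]
  intro y _
  have h : Y.quotπ _ (range_isHomog f) = 0 :=
    zero_of_epi_comp f
      (hom_ext (LinearMap.ext fun x => (Submodule.Quotient.mk_eq_zero _).2 ⟨x, rfl⟩))
  exact (Submodule.Quotient.mk_eq_zero _).1 (LinearMap.congr_fun (congrArg lin h) y)

/-- An injective morphism is a kernel of the projection onto `Y / im f`. -/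
noncomputable def monoIsLimit {X Y : GrMod 𝒜} (f : X ⟶ Y) (hf : Function.Injective (lin f)) :
    IsLimit (KernelFork.ofι (f := Y.quotπ _ (range_isHomog f)) f
      (hom_ext (LinearMap.ext fun x => (Submodule.Quotient.mk_eq_zero _).2 ⟨x, rfl⟩))) :=
  KernelFork.IsLimit.ofι _ _
    (fun {Z} g w =>
      have hg : ∀ z, lin g z ∈ LinearMap.range (lin f) := fun z =>
        (Submodule.Quotient.mk_eq_zero _).1 (lin_apply_eq_zero w z)
      have hl : ∀ z, lin f ((LinearEquiv.ofInjective _ hf).symm ⟨lin g z, hg z⟩) = lin g z :=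
        fun z => congrArg Subtype.val ((LinearEquiv.ofInjective _ hf).apply_symm_apply
          ⟨lin g z, hg z⟩)
      mkHom ((LinearEquiv.ofInjective (lin f) hf).symm.toLinearMap ∘ₗ
        (lin g).codRestrict _ hg) (by
          intro i z hz
          have h₁ := hl z
          set x := (LinearEquiv.ofInjective (lin f) hf).symm ⟨lin g z, hg z⟩ with hx
          have h₂ : X.comp i x = x := hf (by
            rw [lin_comp_apply, h₁, Y.comp_same (lin_map g hz)])
          change x ∈ X.deg i
          rw [← h₂]
          exact X.comp_mem i x))
    (fun {Z} g w => hom_ext (LinearMap.ext fun z =>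
      congrArg Subtype.val ((LinearEquiv.ofInjective (lin f) hf).apply_symm_apply
          ⟨lin g z, _⟩)))
    (fun g w m hm => hom_ext (LinearMap.ext fun z => hf (by
      refine (LinearMap.congr_fun (congrArg lin hm) z).trans ?_
      exact (congrArg Subtype.val ((LinearEquiv.ofInjective (lin f) hf).apply_symm_apply
          ⟨lin g z, _⟩)).symm)))

theorem ker_le_of_subι_comp [Module.Finite k A] {X Y Z : GrMod 𝒜} {f : X ⟶ Y} {g : X ⟶ Z}
    (w : X.subι _ (ker_isHomog f) ≫ g = 0) : LinearMap.ker (lin f) ≤ LinearMap.ker (lin g) :=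
  fun x hx => lin_apply_eq_zero w ⟨x, hx⟩

/-- Descending a morphism through a surjective one. -/
noncomputable def descSurj {X Y Z : GrMod 𝒜} (f : X ⟶ Y) (hf : Function.Surjective (lin f))
    (g : X ⟶ Z) (hg : LinearMap.ker (lin f) ≤ LinearMap.ker (lin g)) : Y ⟶ Z :=
  have h : ∀ x, ((LinearMap.ker (lin f)).liftQ (lin g) hg ∘ₗ
      ((lin f).quotKerEquivOfSurjective hf).symm.toLinearMap) (lin f x) = lin g x := fun x => by
    have h₃ : ((lin f).quotKerEquivOfSurjective hf).symm (lin f x) =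
        Submodule.Quotient.mk x := (LinearEquiv.symm_apply_eq _).2 rfl
    change (LinearMap.ker (lin f)).liftQ (lin g) hg
          (((lin f).quotKerEquivOfSurjective hf).symm (lin f x)) = _
    rw [h₃]
    rfl
  mkHom ((LinearMap.ker (lin f)).liftQ (lin g) hg ∘ₗ
    ((lin f).quotKerEquivOfSurjective hf).symm.toLinearMap) (by
      intro i y hy
      obtain ⟨x, rfl⟩ := hf y
      have h₂ : lin f (X.comp i x) = lin f x := by rw [lin_comp_apply, Y.comp_same hy]
      rw [← h₂, h]
      exact lin_map g (X.comp_mem i x))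

theorem lin_descSurj {X Y Z : GrMod 𝒜} (f : X ⟶ Y) (hf : Function.Surjective (lin f))
    (g : X ⟶ Z) (hg : LinearMap.ker (lin f) ≤ LinearMap.ker (lin g)) (x : X) :
    lin (descSurj f hf g hg) (lin f x) = lin g x := by
  have h₃ : ((lin f).quotKerEquivOfSurjective hf).symm (lin f x) =
      Submodule.Quotient.mk x := (LinearEquiv.symm_apply_eq _).2 rfl
  change (LinearMap.ker (lin f)).liftQ (lin g) hg
        (((lin f).quotKerEquivOfSurjective hf).symm (lin f x)) = _
  rw [h₃]
  rfl

/-- A surjective morphism is a cokernel of the inclusion of its kernel. -/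
noncomputable def epiIsColimit [Module.Finite k A] {X Y : GrMod 𝒜} (f : X ⟶ Y)
    (hf : Function.Surjective (lin f)) :
    IsColimit (CokernelCofork.ofπ (f := X.subι _ (ker_isHomog f)) f
      (hom_ext (LinearMap.ext fun x => x.2))) :=
  CokernelCofork.IsColimit.ofπ _ _
    (fun g w => descSurj f hf g (ker_le_of_subι_comp w))
    (fun g w => hom_ext (LinearMap.ext fun x => lin_descSurj f hf g (ker_le_of_subι_comp w) x))
    (fun g w m hm => hom_ext (LinearMap.ext fun y => by
      obtain ⟨x, rfl⟩ := hf y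
      exact (LinearMap.congr_fun (congrArg lin hm) x).trans (lin_descSurj f hf g _ x).symm))

noncomputable instance [Module.Finite k A] : Abelian (GrMod 𝒜) where
  normalMonoOfMono f _ := ⟨⟨_, _, _, monoIsLimit f (injective_of_mono f)⟩⟩
  normalEpiOfEpi f _ := ⟨⟨_, _, _, epiIsColimit f (surjective_of_epi f)⟩⟩

/-! ### Grade shift and truncation -/

section

variable (𝒜) in
/-- The regular module `A`, graded by `A i = 𝒜 i`. -/
def regular [GradedAlgebra 𝒜] : GrMod 𝒜 where
  carrier := A
  deg i := (𝒜 i).toAddSubgroup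
  isInternal := DirectSum.Decomposition.isInternal 𝒜
  gradedSMul := ⟨fun _ _ _ _ ha hx => SetLike.GradedMonoid.toGradedMul.mul_mem ha hx⟩

/-- The grade shift `X(n)`, with `X(n) j = X (n + j)`. -/
def shift (X : GrMod 𝒜) (n : ℤ) : GrMod 𝒜 where
  carrier := X
  deg j := X.deg (n + j)
  isInternal := by
    refine IntGrading.isInternal_of_comp (fun j => X.comp (n + j)) ?_ ?_ ?_
    · exact fun i x hx => X.comp_same hx
    · exact fun i j hij x hx => X.comp_ne hx (by simpa using hij)
    · intro x
      obtain ⟨s, hs⟩ := X.exists_sum x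
      rw [← hs]
      refine sum_mem fun i _ => AddSubgroup.mem_iSup_of_mem (i - n) ?_
      rw [add_sub_cancel]
      exact X.comp_mem i x
  gradedSMul := ⟨fun i j _ _ ha hx => by
    have h := SetLike.GradedSMul.smul_mem (A := 𝒜) (B := X.deg) ha hx
    rwa [vadd_eq_add, add_left_comm] at h⟩

/-- The submodule `X_{≥ n}` of `X`, generated by the homogeneous elements of degree `≥ n`.
If `A` is positively graded, it is `⨁ j ≥ n, X j`, see `mem_geSubmodule_iff`. -/
def geSubmodule (X : GrMod 𝒜) (n : ℤ) : Submodule A X :=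
  Submodule.span A {x | ∃ j, n ≤ j ∧ x ∈ X.deg j}

variable [GradedAlgebra 𝒜]

theorem comp_smul_mem (X : GrMod 𝒜) (S : Submodule A X) {j : ℤ} {x : X} (hx : x ∈ X.deg j)
    (hxS : x ∈ S) (a : A) (i : ℤ) : X.comp i (a • x) ∈ S := by
  classical
  rw [← DirectSum.sum_support_decompose 𝒜 a, Finset.sum_smul, map_sum]
  refine sum_mem fun l _ => ?_
  have h : (DirectSum.decompose 𝒜 a l : A) • x ∈ X.deg (l + j) :=
    SetLike.GradedSMul.smul_mem (A := 𝒜) (B := X.deg) (SetLike.coe_mem _) hx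
  by_cases hij : l + j = i
  · subst hij
    rw [X.comp_same h]
    exact S.smul_mem _ hxS
  · rw [X.comp_ne h hij]
    exact S.zero_mem

theorem geSubmodule_isHomog (X : GrMod 𝒜) (n : ℤ) : X.IsHomog (X.geSubmodule n) := by
  intro x hx
  refine Submodule.span_induction (p := fun x _ => ∀ i, X.comp i x ∈ X.geSubmodule n)
    ?_ ?_ ?_ ?_ hx
  · rintro x ⟨j, hj, hxj⟩ i
    by_cases hij : j = i
    · subst hij
      rw [X.comp_same hxj]
      exact Submodule.subset_span ⟨j, hj, hxj⟩
    · rw [X.comp_ne hxj hij]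
      exact zero_mem _
  · intro i
    rw [map_zero]
    exact zero_mem _
  · intro x y _ _ hx hy i
    rw [map_add]
    exact add_mem (hx i) (hy i)
  · intro a x _ hx i
    obtain ⟨s, hs⟩ := X.exists_sum x
    rw [← hs, Finset.smul_sum, map_sum]
    exact sum_mem fun j _ => X.comp_smul_mem _ (X.comp_mem j x) (hx j) a i

theorem mem_geSubmodule_iff (hpos : ∀ i < 0, 𝒜 i = ⊥) (X : GrMod 𝒜) (n : ℤ) (x : X) :
    x ∈ X.geSubmodule n ↔ ∀ j < n, X.comp j x = 0 := by
  classical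
  constructor
  · intro hx
    refine Submodule.span_induction (p := fun x _ => ∀ j < n, X.comp j x = 0) ?_ ?_ ?_ ?_ hx
    · rintro x ⟨i, hi, hxi⟩ j hj
      exact X.comp_ne hxi (by lia)
    · intro j _
      exact map_zero _
    · intro x y _ _ hx hy j hj
      rw [map_add, hx j hj, hy j hj, add_zero]
    · intro a x _ hx j hj
      obtain ⟨s, hs⟩ := X.exists_sum x
      rw [← hs, Finset.smul_sum, map_sum]
      refine Finset.sum_eq_zero fun i _ => ?_
      by_cases hi : i < n
      · rw [hx i hi, smul_zero, map_zero]
      rw [← DirectSum.sum_support_decompose 𝒜 a, Finset.sum_smul, map_sum]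
      refine Finset.sum_eq_zero fun l _ => ?_
      have h : (DirectSum.decompose 𝒜 a l : A) • X.comp i x ∈ X.deg (l + i) :=
        SetLike.GradedSMul.smul_mem (A := 𝒜) (B := X.deg) (SetLike.coe_mem _) (X.comp_mem i x)
      by_cases hl : l < 0
      · have h0 : (DirectSum.decompose 𝒜 a l : A) = 0 := by
          have h' := (hpos l hl).le (DirectSum.decompose 𝒜 a l).2
          exact h'
        rw [h0, zero_smul, map_zero]
      · exact X.comp_ne h (by lia)
  · intro hx
    obtain ⟨s, hs⟩ := X.exists_sum x
    rw [← hs]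
    refine sum_mem fun i _ => ?_
    by_cases hi : i < n
    · rw [hx i hi]
      exact zero_mem _
    · exact Submodule.subset_span ⟨i, by lia, X.comp_mem i x⟩

/-- The truncation `X_{≤ n} = X / X_{≥ n + 1}`. -/
def truncLE (X : GrMod 𝒜) (n : ℤ) : GrMod 𝒜 :=
  X.quot (X.geSubmodule (n + 1)) (X.geSubmodule_isHomog _)

end

end GrMod

/-! ## Singularity categories -/

universe w v u'

/-- The terms of the mapping cone of a morphism between complexes of projectives are projective. -/
theorem projective_mappingCone {C : Type u'} [Category.{v} C] [Abelian C]
    {K L : CochainComplex C ℤ} (f : K ⟶ L)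
    (hK : ∀ n, Projective (K.X n)) (hL : ∀ n, Projective (L.X n)) (n : ℤ) :
    Projective ((CochainComplex.mappingCone f).X n) :=
  Projective.of_iso (HomologicalComplex.homotopyCofiber.XIsoBiprod f n (n + 1) rfl).symm
    inferInstance

section Singularity

open DerivedCategory

variable (C : Type u') [Category.{v} C] [Abelian C] [HasDerivedCategory.{w} C]

/-- The bounded derived category `D^b(C)`: the full subcategory of `D(C)` of the complexes
with bounded cohomology. -/
abbrev BoundedDerivedCategory : Type (max u' v) :=
  (TStructure.t (C := C)).bounded.FullSubcategory

/-- The objects of `D(C)` which are isomorphic to a bounded complex of projective objects. -/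
def perfectComplexes : ObjectProperty (DerivedCategory C) := fun X =>
  ∃ (K : CochainComplex C ℤ) (a b : ℤ), K.IsStrictlyGE a ∧ K.IsStrictlyLE b ∧
    (∀ n, Projective (K.X n)) ∧ Nonempty (X ≅ Q.obj K)

instance : (perfectComplexes C).IsClosedUnderIsomorphisms where
  of_iso := by
    rintro X Y e ⟨K, a, b, ha, hb, hK, ⟨e'⟩⟩
    exact ⟨K, a, b, ha, hb, hK, ⟨e.symm ≪≫ e'⟩⟩

instance : (perfectComplexes C).ContainsZero where
  exists_zero := by
    have h : ∀ i, IsZero ((HomologicalComplex.zero (V := C) (c := ComplexShape.up ℤ)).X i) :=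
      fun _ => isZero_zero C
    refine ⟨Q.obj HomologicalComplex.zero, Functor.map_isZero _ HomologicalComplex.isZero_zero,
      _, 0, 0, ?_, ?_, ?_, ⟨Iso.refl _⟩⟩
    · exact (CochainComplex.isStrictlyGE_iff _ _).2 fun i _ => h i
    · exact (CochainComplex.isStrictlyLE_iff _ _).2 fun i _ => h i
    · exact fun i => (h i).projective

instance : (perfectComplexes C).IsStableUnderShift ℤ where
  isStableUnderShiftBy n := ⟨by
    rintro X ⟨K, a, b, ha, hb, hK, ⟨e⟩⟩
    exact ⟨K⟦n⟧, a - n, b - n, K.isStrictlyGE_shift a n (a - n) (by lia),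
      K.isStrictlyLE_shift b n (b - n) (by lia), fun i => hK (i + n),
      ⟨(shiftFunctor _ n).mapIso e ≪≫ (Q.commShiftIso n).symm.app K⟩⟩⟩

instance : (perfectComplexes C).IsTriangulatedClosed₃ :=
  .mk' (by
    rintro T hT ⟨K, a, b, ha, hb, hK, ⟨e⟩⟩ ⟨L, a', b', ha', hb', hL, ⟨e'⟩⟩
    have : K.IsKProjective := CochainComplex.isKProjective_of_projective K b
    obtain ⟨f, hf⟩ : ∃ f : K ⟶ L, Q.map f = e.inv ≫ T.mor₁ ≫ e'.hom := by
      obtain ⟨g, hg⟩ := (CochainComplex.IsKProjective.Qh_map_bijective K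
        ((HomotopyCategory.quotient _ _).obj L)).surjective
        ((quotientCompQhIso C).hom.app K ≫ (e.inv ≫ T.mor₁ ≫ e'.hom) ≫
          (quotientCompQhIso C).inv.app L)
      obtain ⟨f, rfl⟩ := (HomotopyCategory.quotient C (ComplexShape.up ℤ)).map_surjective g
      refine ⟨f, ?_⟩
      rw [← cancel_epi ((quotientCompQhIso C).hom.app K), ← quotientCompQhIso_hom_naturality, hg]
      simp
    refine ⟨CochainComplex.mappingCone f, min (a - 1) a', max b b', ?_, ?_,
      projective_mappingCone f hK hL, ⟨?_⟩⟩
    · rw [CochainComplex.isStrictlyGE_iff]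
      intro i hi
      rw [CochainComplex.mappingCone.isZero_X_iff]
      exact ⟨K.isZero_of_isStrictlyGE a _, L.isZero_of_isStrictlyGE a' _⟩
    · rw [CochainComplex.isStrictlyLE_iff]
      intro i hi
      rw [CochainComplex.mappingCone.isZero_X_iff]
      exact ⟨K.isZero_of_isStrictlyLE b _, L.isZero_of_isStrictlyLE b' _⟩
    · exact Pretriangulated.Triangle.π₃.mapIso (Pretriangulated.isoTriangleOfIso₁₂ _ _ hT
        (mappingCone_triangle_distinguished f) e e' (by
          change T.mor₁ ≫ e'.hom = e.hom ≫ Q.map f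
          rw [hf]
          simp)))

instance : (perfectComplexes C).IsTriangulated where
  toIsTriangulatedClosed₂ := .of_isTriangulatedClosed₃

/-- The objects of `D^b(C)` which lie in `K^b(proj C)`. -/
abbrev boundedPerfectComplexes : ObjectProperty (BoundedDerivedCategory C) :=
  (perfectComplexes C).inverseImage (TStructure.t (C := C)).bounded.ι

/-- The singularity category `D^b(C) / K^b(proj C)`: the Verdier quotient, i.e. the localization
of `D^b(C)` at the morphisms whose cone lies in `K^b(proj C)`. -/
abbrev SingularityCategory : Type (max u' v) :=
  (boundedPerfectComplexes C).trW.Localization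

variable {C} in
/-- An object of `C`, as a stalk complex in degree `0`, in `D^b(C)`. -/
noncomputable def BoundedDerivedCategory.stalk (X : C) : BoundedDerivedCategory C where
  obj := (singleFunctor C 0).obj X
  property := ⟨⟨0, inferInstance⟩, ⟨0, inferInstance⟩⟩

variable {C} in
/-- An object of `C`, as a stalk complex in degree `0`, in the singularity category. -/
noncomputable def SingularityCategory.stalk (X : C) : SingularityCategory C :=
  (boundedPerfectComplexes C).trW.Q.obj (BoundedDerivedCategory.stalk X)

end Singularity

/-! ## Silting objects, Gorenstein algebras, global dimension -/

/-- An object `T` of a triangulated category is silting if `Hom(T, T[m]) = 0` for all `m > 0`,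
and if the smallest triangulated subcategory which contains `T` and is closed under
direct summands (the thick subcategory generated by `T`) is the whole category. -/
structure IsSilting {D : Type*} [Category* D] [HasZeroObject D] [HasShift D ℤ] [Preadditive D]
    [∀ n : ℤ, (shiftFunctor D n).Additive] [Pretriangulated D] (T : D) : Prop where
  hom_eq_zero : ∀ m : ℤ, 0 < m → ∀ f : T ⟶ T⟦m⟧, f = 0
  thick_eq_top : (ObjectProperty.singleton T).triangEnvelope = ⊤

/-- The ring `A` is `d`-Gorenstein: the injective dimensions of `A` as a left
and as a right module over itself are at most `d`. -/
def IsGorensteinOfDimLE (A : Type u) [Ring A] (d : ℕ) : Prop :=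
  HasInjectiveDimensionLE (ModuleCat.of A A) d ∧ HasInjectiveDimensionLE (ModuleCat.of Aᵐᵒᵖ A) d

/-- The ring `R` has finite (left) global dimension: the projective dimensions of
its modules are bounded. -/
def HasFiniteGlobalDimension (R : Type u) [Ring R] : Prop :=
  ∃ d : ℕ, ∀ M : ModuleCat.{u} R, HasProjectiveDimensionLE M d

/-! ## The graded singularity category -/

noncomputable instance {k A : Type u} [Field k] [Ring A] [Algebra k A] [Module.Finite k A]
    (𝒜 : ℤ → Submodule k A) : HasDerivedCategory.{u + 1} (GrMod 𝒜) :=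
  HasDerivedCategory.standard _

/-- The graded singularity category `D_sg(mod^ℤ A) = D^b(mod^ℤ A) / K^b(proj^ℤ A)`. -/
abbrev GradedSingularityCategory {k A : Type u} [Field k] [Ring A] [Algebra k A]
    [Module.Finite k A] (𝒜 : ℤ → Submodule k A) : Type (u + 1) :=
  SingularityCategory (GrMod 𝒜)

/-- The graded module `A(i)_{≤ 0}`, as an object of `D_sg(mod^ℤ A)`. -/
noncomputable def shiftTrunc {k A : Type u} [Field k] [Ring A] [Algebra k A]
    [Module.Finite k A] (𝒜 : ℤ → Submodule k A) [GradedAlgebra 𝒜] (i : ℕ) :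
    GradedSingularityCategory 𝒜 :=
  SingularityCategory.stalk (((GrMod.regular 𝒜).shift i).truncLE 0)

/-!
Write `T i = A(i)_{≤ 0}`.  Since `A` is finite-dimensional, `A(i)_{≤ 0} = A(i)` is projective for
large `i`, so almost all the `T i` vanish in the singularity category, and their coproduct is a
finite biproduct.  The object so obtained is silting for the following two reasons.

*Vanishing.*  The kernel of `A(i) ⟶ T i` lives in degrees `≥ 1`; as `A` is positively graded, it has
a projective resolution by graded modules living in degrees `≥ 1`, while `T j` lives in degrees
`≤ 0`.  Hence `Ext^m(T i, T j) = 0` for all `m ≥ 1` (`GrMod.ext_shiftTrunc_eq_zero`).  To pass to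
the singularity category, represent a morphism `T i ⟶ (T j)[m]` by a roof `T i ⟶ Y ⟵ (T j)[m]` such
that the cone of the second arrow is a bounded complex `C` of projectives.  As projective graded modules
have injective dimension at most one, the composite `T i ⟶ Y ⟶ C` factors through the stupid
truncation of `C` to degrees `≥ -1`, from which there are no nonzero morphisms to `(T j)[m + 1]`,
which lives in degree `-m - 1 < -1`.  So `T i ⟶ Y` is, up to a morphism which factors through a
perfect complex, induced by a morphism `T i ⟶ (T j)[m]` in the derived category, and the latter is
zero (`trW_Q_hom_eq_zero`, `SingularityCategory.stalk_hom_shift_eq_zero`).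

*Generation.*  Let `S` be a thick subcategory of the singularity category which contains all the
`T i`.  The graded modules whose stalk complex is in `S` form a class `G` which contains the
projectives, is closed under direct summands, and has the two out of three property for short exact
sequences.  Bounded complexes are iterated extensions of shifted stalk complexes, so it is enough
that `G` contains all graded modules; by filtering by degrees, it is enough that it contains each
finitely generated `A₀`-module `V`, placed in a single degree `j`.

* For `j = -n ≤ 0`, the module `T n` maps onto `A₀`, placed in degree `-n`, with kernel in
  degrees `-n + 1, …, 0`.  By induction on `n`, `G` contains `A₀` placed in degree `-n`, hence
  also every `V`, as `V` has a finite resolution by finitely generated projective `A₀`-modules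
  (`GrMod.concentrated_neg`).
* For `j = n > 0`, consider the dual `D A = Hom_k(A, k)` of the right module `A`.  Since `A` has
  injective dimension at most one as a right module, `D A` has projective dimension at most one, so
  that `D A(-n)` is in `G` (`GrMod.prop_dualRegular_shift`).  Its component of highest degree `n` is
  the submodule `D A₀`.  By induction on `n`, `G` contains `D A₀` placed in degree `n`, hence also
  every `V`, as `V` has a finite coresolution by summands of finite powers of `D A₀`
  (`GrMod.concentrated_pos`).
-/

/-! ### Verdier quotients -/

section Verdier

open Pretriangulated ZeroObject

variable {D : Type*} [Category* D] [HasZeroObject D] [HasShift D ℤ] [Preadditive D]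
  [∀ n : ℤ, (shiftFunctor D n).Additive] [Pretriangulated D] [IsTriangulated D]

theorem isZero_trW_Q_obj (P : ObjectProperty D) [P.IsTriangulated] {E : D} (hE : P E) :
    IsZero (P.trW.Q.obj E) := by
  have h : P.trW (0 : (0 : D) ⟶ E) :=
    ObjectProperty.trW.mk P (contractible_distinguished₁ E) hE
  have : IsIso (P.trW.Q.map (0 : (0 : D) ⟶ E)) := Localization.inverts P.trW.Q P.trW _ h
  exact (P.trW.Q.map_isZero (isZero_zero D)).of_iso (asIso (P.trW.Q.map (0 : (0 : D) ⟶ E))).symm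

/-- A criterion for the vanishing of `Hom(G, Y)` in the Verdier quotient by `P`, when there are no
nonzero morphisms `G ⟶ Y` already: morphisms from `G` to objects `C` of `P` need to factor through
objects of `P` which do not see a given `C ⟶ Y⟦1⟧`. -/
theorem trW_Q_hom_eq_zero (P : ObjectProperty D) [P.IsTriangulated] {G Y : D}
    (h₀ : ∀ f : G ⟶ Y, f = 0)
    (hP : ∀ C : D, P C → ∀ (u : G ⟶ C) (v : C ⟶ Y⟦(1 : ℤ)⟧),
      ∃ (E : D) (a : G ⟶ E) (b : E ⟶ C), P E ∧ a ≫ b = u ∧ b ≫ v = 0)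
    (f : P.trW.Q.obj G ⟶ P.trW.Q.obj Y) : f = 0 := by
  -- `f` is the fraction `G ⟶ Y' ⟵ Y`, and `C` is the cone of the second arrow
  obtain ⟨φ, hφ⟩ := Localization.exists_leftFraction P.trW.Q P.trW f
  obtain ⟨C, p, q, hT, hC⟩ := φ.hs
  obtain ⟨E, a, b, hE, hab, hbv⟩ := hP C hC (φ.f ≫ p) q
  obtain ⟨e, he⟩ : ∃ e : E ⟶ φ.Y', b = e ≫ p := Triangle.coyoneda_exact₃ _ hT b hbv
  obtain ⟨g, hg⟩ : ∃ g : G ⟶ Y, φ.f - a ≫ e = g ≫ φ.s :=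
    Triangle.coyoneda_exact₂ _ hT (φ.f - a ≫ e) (by
      change (φ.f - a ≫ e) ≫ p = 0
      rw [Preadditive.sub_comp, Category.assoc, ← he, hab, sub_self])
  -- the numerator factors through `E`, which is zero in the quotient
  have hf : φ.f = a ≫ e := by
    rw [← sub_eq_zero, hg, h₀ g, zero_comp]
  have hz : P.trW.Q.map φ.f = 0 := by
    rw [hf, Functor.map_comp, (isZero_trW_Q_obj P hE).eq_of_tgt (P.trW.Q.map a) 0, zero_comp]
  have : IsIso (P.trW.Q.map φ.s) := Localization.inverts P.trW.Q P.trW _ φ.hs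
  rw [hφ, ← cancel_mono (P.trW.Q.map φ.s), MorphismProperty.LeftFraction.map_comp_map_s, hz,
    zero_comp]

end Verdier

/-! ### Stupid truncations of bounded complexes -/

section Perfect

open DerivedCategory Pretriangulated

variable {C : Type u'} [Category.{v} C] [Abelian C] [HasDerivedCategory.{w} C]

/-- A complex `K` which vanishes in degrees `< a` is an extension of `K.X a`, placed in degree `a`,
by the stupid truncation `K'` of `K` to degrees `≥ a + 1`. -/
theorem exists_stupid_truncation_step (K : CochainComplex C ℤ) (a b : ℤ) [K.IsStrictlyGE a]
    [K.IsStrictlyLE b] :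
    ∃ (K' : CochainComplex C ℤ) (i : K' ⟶ K) (g : Q.obj K ⟶ (singleFunctor C a).obj (K.X a))
      (δ : (singleFunctor C a).obj (K.X a) ⟶ (Q.obj K')⟦(1 : ℤ)⟧),
      K'.IsStrictlyGE (a + 1) ∧ K'.IsStrictlyLE b ∧
      (∀ n, IsZero (K'.X n) ∨ Nonempty (K'.X n ≅ K.X n)) ∧
      Triangle.mk (Q.map i) g δ ∈ distTriang (DerivedCategory C) := by
  let f : K ⟶ (HomologicalComplex.single C (ComplexShape.up ℤ) a).obj (K.X a) :=
    HomologicalComplex.mkHomToSingle (𝟙 _) (fun i hi => by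
      have : i < a := by simp at hi; lia
      exact (K.isZero_of_isStrictlyGE a i).eq_of_src _ _)
  have hfa : IsIso (f.f a) := by
    dsimp [f]
    simp only [HomologicalComplex.mkHomToSingle_f]
    infer_instance
  have hzero : ∀ n, n ≠ a → IsZero (((HomologicalComplex.single C (ComplexShape.up ℤ) a).obj
      (K.X a)).X n) := fun n hn => HomologicalComplex.isZero_single_obj_X _ _ _ _ hn
  have : Epi f := by
    have : ∀ n, Epi (f.f n) := fun n => by
      by_cases hn : n = a
      · subst hn; infer_instance
      · exact ⟨fun g h _ => (hzero n hn).eq_of_src _ _⟩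
    exact HomologicalComplex.epi_of_epi_f f this
  have hS : (ShortComplex.mk _ _ (kernel.condition f)).ShortExact :=
    { exact := ShortComplex.exact_kernel f }
  have hSn : ∀ n, ((ShortComplex.mk _ _ (kernel.condition f)).map
      (HomologicalComplex.eval C (ComplexShape.up ℤ) n)).ShortExact :=
    fun n => hS.map_of_exact _
  have hXa : IsZero ((kernel f).X a) := by
    have h : Mono ((kernel.ι f).f a) := (hSn a).mono_f
    rw [IsZero.iff_id_eq_zero, ← cancel_mono ((kernel.ι f).f a), ← cancel_mono (f.f a)]
    have : (kernel.ι f).f a ≫ f.f a = 0 := ((ShortComplex.mk _ _ (kernel.condition f)).map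
      (HomologicalComplex.eval C (ComplexShape.up ℤ) a)).zero
    simp [this]
  have hX : ∀ n, n ≠ a → Nonempty ((kernel f).X n ≅ K.X n) := fun n hn => by
    have : IsIso ((kernel.ι f).f n) := (hSn n).isIso_f_iff.2 (hzero n hn)
    exact ⟨asIso ((kernel.ι f).f n)⟩
  refine ⟨kernel f, kernel.ι f, Q.map f ≫ (singleFunctorIsoCompQ C a).inv.app _,
    (singleFunctorIsoCompQ C a).hom.app _ ≫ triangleOfSESδ hS, ?_, ?_, ?_, ?_⟩
  · rw [CochainComplex.isStrictlyGE_iff]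
    intro n hn
    by_cases hna : n = a
    · exact hna ▸ hXa
    · exact (K.isZero_of_isStrictlyGE a n (by lia)).of_iso (hX n hna).some
  · rw [CochainComplex.isStrictlyLE_iff]
    intro n hn
    by_cases hna : n = a
    · exact hna ▸ hXa
    · exact (K.isZero_of_isStrictlyLE b n (by lia)).of_iso (hX n hna).some
  · intro n
    by_cases hna : n = a
    · exact .inl (hna ▸ hXa)
    · exact .inr (hX n hna)
  · refine isomorphic_distinguished _ (triangleOfSES_distinguished hS) _
      (Triangle.isoMk _ _ (Iso.refl _) (Iso.refl _) ((singleFunctorIsoCompQ C a).app _) ?_ ?_ ?_)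
    · exact (Category.comp_id _).trans (Category.id_comp _).symm
    · refine (Category.assoc _ _ _).trans ?_
      refine (congrArg (fun t => Q.map f ≫ t)
        ((singleFunctorIsoCompQ C a).inv_hom_id_app (K.X a))).trans ?_
      exact (Category.comp_id _).trans (Category.id_comp _).symm
    · refine Eq.trans ?_ (Category.comp_id _)
      congr 1
      exact (shiftFunctor (DerivedCategory C) (1 : ℤ)).map_id _

omit [HasDerivedCategory.{w} C] in
theorem projective_X_of_isZero_or_iso {K K' : CochainComplex C ℤ}
    (h : ∀ n, IsZero (K'.X n) ∨ Nonempty (K'.X n ≅ K.X n)) (hK : ∀ n, Projective (K.X n)) (n : ℤ) :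
    Projective (K'.X n) := by
  obtain h | ⟨⟨e⟩⟩ := h n
  · exact h.projective
  · exact Projective.of_iso e.symm (hK n)

/-- There are no nonzero morphisms from a bounded complex of projectives, living in degrees `≥ a`,
to an object whose cohomology lives in degrees `< a`. -/
theorem hom_eq_zero_of_isStrictlyGE (K : CochainComplex C ℤ) (a b : ℤ) [hGE : K.IsStrictlyGE a]
    [hLE : K.IsStrictlyLE b] (hK : ∀ n, Projective (K.X n)) (Y : DerivedCategory C) (n : ℤ)
    [Y.IsLE n] (hn : n < a) (f : Q.obj K ⟶ Y) : f = 0 := by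
  obtain ⟨d, hd⟩ : ∃ d : ℕ, b + 1 - a ≤ d := ⟨(b + 1 - a).toNat, by simp⟩
  induction d generalizing K a with
  | zero =>
    have hz : IsZero K := by
      rw [IsZero.iff_id_eq_zero]
      ext i
      by_cases hi : i < a
      · exact (K.isZero_of_isStrictlyGE a i).eq_of_src _ _
      · exact (K.isZero_of_isStrictlyLE b i (by push_cast at hd; lia)).eq_of_src _ _
    exact (Q.map_isZero hz).eq_of_src _ _
  | succ d ih =>
    obtain ⟨K', i, g, δ, h₁, h₂, h₃, hT⟩ := exists_stupid_truncation_step K a b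
    obtain ⟨q, hq⟩ := Triangle.yoneda_exact₂ _ hT f
      (ih K' (a + 1) (projective_X_of_isZero_or_iso h₃ hK) (by lia) _ (by push_cast at hd; lia))
    obtain ⟨L, _, ⟨e⟩⟩ := Y.exists_iso_Q_obj_of_isLE n
    have := hK a
    have : q ≫ e.hom = 0 := from_singleFunctor_obj_eq_zero_of_projective
      (P := K.X a) (i := a) (q ≫ e.hom) n hn
    have hq0 : q = 0 := by rwa [← cancel_mono e.hom, zero_comp]
    rw [hq, hq0]
    exact comp_zero

/-- If `M` has no extensions of degree `≥ 2` by projectives, then a morphism from `M` to a bounded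
complex `K` of projectives factors through the stupid truncation of `K` to degrees `≥ -1`. -/
theorem exists_factorization_through_truncation (M : C)
    (hM : ∀ (P : C) [Projective P] (m : ℤ), 2 ≤ m →
      ∀ f : (singleFunctor C 0).obj M ⟶ ((singleFunctor C 0).obj P)⟦m⟧, f = 0)
    (K : CochainComplex C ℤ) (a b : ℤ) [K.IsStrictlyGE a]
    [K.IsStrictlyLE b] (hK : ∀ n, Projective (K.X n)) (u : (singleFunctor C 0).obj M ⟶ Q.obj K) :
    ∃ (K' : CochainComplex C ℤ) (p : (singleFunctor C 0).obj M ⟶ Q.obj K')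
      (i : Q.obj K' ⟶ Q.obj K), p ≫ i = u ∧ K'.IsStrictlyGE (-1) ∧ K'.IsStrictlyLE b ∧
        (∀ n, Projective (K'.X n)) := by
  obtain ⟨d, hd⟩ : ∃ d : ℕ, -1 - a ≤ d := ⟨(-1 - a).toNat, by simp⟩
  induction d generalizing K a with
  | zero =>
    exact ⟨K, u, 𝟙 _, by simp, K.isStrictlyGE_of_ge (-1) a (by push_cast at hd; lia),
      inferInstance, hK⟩
  | succ d ih =>
    by_cases ha : -1 ≤ a
    · exact ⟨K, u, 𝟙 _, by simp, K.isStrictlyGE_of_ge (-1) a ha, inferInstance, hK⟩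
    obtain ⟨K', i, g, δ, h₁, h₂, h₃, hT⟩ := exists_stupid_truncation_step K a b
    have := hK a
    have hug : u ≫ g = 0 := by
      let e := ((singleFunctors C).shiftIso (-a) a 0 (by lia)).app (K.X a)
      have := hM (K.X a) (-a) (by lia) ((u ≫ g) ≫ e.inv)
      rwa [← cancel_mono e.inv, zero_comp]
    obtain ⟨u', hu'⟩ := Triangle.coyoneda_exact₂ _ hT u hug
    obtain ⟨K'', p, j, hpj, h⟩ := ih K' (a + 1) (projective_X_of_isZero_or_iso h₃ hK) u'
      (by push_cast at hd; lia)
    exact ⟨K'', p, j ≫ Q.map i, by rw [← Category.assoc, hpj]; exact hu'.symm, h⟩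

end Perfect

/-! ### Stalk complexes in the singularity category -/

section Thick

variable {C : Type u'} [Category.{v} C] [Abelian C]

/-- A class of objects of an abelian category is thick if it is closed under direct summands, and
contains all the terms of a short exact sequence as soon as it contains two of them. -/
structure CategoryTheory.ObjectProperty.IsThickInAbelian (G : ObjectProperty C) : Prop where
  of_retract {X Y : C} (r : Retract X Y) (hY : G Y) : G X
  of_shortExact₁ {S : ShortComplex C} (hS : S.ShortExact) (h₂ : G S.X₂) (h₃ : G S.X₃) : G S.X₁
  of_shortExact₂ {S : ShortComplex C} (hS : S.ShortExact) (h₁ : G S.X₁) (h₃ : G S.X₃) : G S.X₂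
  of_shortExact₃ {S : ShortComplex C} (hS : S.ShortExact) (h₁ : G S.X₁) (h₂ : G S.X₂) : G S.X₃

end Thick

namespace SingularityCategory

open DerivedCategory Pretriangulated

variable {C : Type u'} [Category.{v} C] [Abelian C] [HasDerivedCategory.{w} C]

/-- If `M` has no extensions of degree `≥ 2` by projectives, and no extensions of degree `≥ 1`
by `N`, then there are no nonzero morphisms `M ⟶ N⟦m⟧`, `m > 0`, in the singularity category. -/
theorem stalk_hom_shift_eq_zero {M N : C}
    (hM : ∀ (P : C) [Projective P] (m : ℕ), 2 ≤ m →
      ∀ f : (singleFunctor C 0).obj M ⟶ ((singleFunctor C 0).obj P)⟦(m : ℤ)⟧, f = 0)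
    (hMN : ∀ m : ℕ, 1 ≤ m →
      ∀ f : (singleFunctor C 0).obj M ⟶ ((singleFunctor C 0).obj N)⟦(m : ℤ)⟧, f = 0)
    (m : ℤ) (hm : 0 < m) (f : stalk M ⟶ (stalk N)⟦m⟧) : f = 0 := by
  let B := (TStructure.t (C := C)).bounded
  let P := boundedPerfectComplexes C
  suffices h : ∀ g : P.trW.Q.obj (BoundedDerivedCategory.stalk M) ⟶
      P.trW.Q.obj ((BoundedDerivedCategory.stalk N)⟦m⟧), g = 0 by
    let e : P.trW.Q.obj ((BoundedDerivedCategory.stalk N)⟦m⟧) ≅ (stalk N)⟦m⟧ :=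
      (P.trW.Q.commShiftIso m).app (BoundedDerivedCategory.stalk N)
    have := h (f ≫ e.inv)
    rwa [← cancel_mono e.inv, zero_comp]
  refine trW_Q_hom_eq_zero P (fun g => ?_) (fun X hX u v => ?_)
  · let e := (B.ι.commShiftIso m).app (BoundedDerivedCategory.stalk N)
    refine B.ι.map_injective ?_
    rw [← cancel_mono e.hom, Functor.map_zero, zero_comp]
    lift m to ℕ using hm.le
    exact hMN m (by lia) _
  · obtain ⟨K, a, b, _, _, hK, ⟨eK⟩⟩ := hX
    obtain ⟨K', p, i, hpi, _, _, hK'⟩ := exists_factorization_through_truncation M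
      (fun P _ m hm f => by
        lift m to ℕ using by lia
        exact hM P m (by lia) f) K a b hK
      (u := B.ι.map u ≫ eK.hom)
    replace hpi : (p ≫ i) ≫ eK.inv = B.ι.map u :=
      (Iso.comp_inv_eq eK).2 hpi
    have hQK' : B (Q.obj K') := ⟨⟨-1, inferInstance⟩, ⟨b, inferInstance⟩⟩
    refine ⟨⟨Q.obj K', hQK'⟩, ObjectProperty.homMk p, ObjectProperty.homMk (i ≫ eK.inv),
      ⟨K', -1, b, inferInstance, inferInstance, hK', ⟨Iso.refl _⟩⟩, ?_, ?_⟩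
    · refine B.ι.map_injective ?_
      change p ≫ i ≫ eK.inv = B.ι.map u
      rw [← Category.assoc, hpi]
    · refine B.ι.map_injective ?_
      let e : B.ι.obj (((BoundedDerivedCategory.stalk N)⟦m⟧)⟦(1 : ℤ)⟧) ≅
          (((singleFunctor C 0).obj N)⟦m⟧)⟦(1 : ℤ)⟧ :=
        (B.ι.commShiftIso (1 : ℤ)).app ((BoundedDerivedCategory.stalk N)⟦m⟧) ≪≫
        (shiftFunctor _ (1 : ℤ)).mapIso ((B.ι.commShiftIso m).app (BoundedDerivedCategory.stalk N))
      rw [← cancel_mono e.hom, Functor.map_zero, zero_comp]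
      have h₀ : ((singleFunctor C 0).obj N).IsLE 0 := inferInstance
      have h₁ : (((singleFunctor C 0).obj N)⟦m⟧).IsLE (-m) :=
        TStructure.t.isLE_shift ((singleFunctor C 0).obj N) 0 m (-m)
      have h₂ : ((((singleFunctor C 0).obj N)⟦m⟧)⟦(1 : ℤ)⟧).IsLE (-m-1) :=
        TStructure.t.isLE_shift (((singleFunctor C 0).obj N)⟦m⟧) (-m) 1 (-m-1)
      exact hom_eq_zero_of_isStrictlyGE K' (-1) b hK' _ (-m - 1) (by lia) _

/-- The objects of the derived category which are bounded and whose image in the singularity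
category satisfies `S`. -/
def derivedPreimage (S : ObjectProperty (SingularityCategory C)) :
    ObjectProperty (DerivedCategory C) :=
  (S.inverseImage (boundedPerfectComplexes C).trW.Q).map (TStructure.t (C := C)).bounded.ι

instance (S : ObjectProperty (SingularityCategory C)) [S.IsTriangulated]
    [S.IsClosedUnderIsomorphisms] : (derivedPreimage S).IsTriangulated := by
  have (S' : ObjectProperty (BoundedDerivedCategory C)) [S'.IsTriangulated] :
      (S'.map (TStructure.t (C := C)).bounded.ι).IsTriangulated := inferInstance
  exact this (S.inverseImage (boundedPerfectComplexes C).trW.Q)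

instance (S : ObjectProperty (SingularityCategory C)) :
    (derivedPreimage S).IsClosedUnderIsomorphisms := by
  unfold derivedPreimage
  infer_instance

theorem derivedPreimage_obj_iff (S : ObjectProperty (SingularityCategory C))
    [S.IsClosedUnderIsomorphisms] (X : BoundedDerivedCategory C) :
    derivedPreimage S X.obj ↔ S ((boundedPerfectComplexes C).trW.Q.obj X) := by
  constructor
  · rintro ⟨Y, hY, ⟨e⟩⟩
    exact S.prop_of_iso ((boundedPerfectComplexes C).trW.Q.mapIso
      ((TStructure.t (C := C)).bounded.ι.preimageIso e)) hY
  · intro h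
    exact ⟨X, h, ⟨Iso.refl _⟩⟩

theorem derivedPreimage_single_iff (S : ObjectProperty (SingularityCategory C))
    [S.IsClosedUnderIsomorphisms] (M : C) :
    derivedPreimage S ((singleFunctor C 0).obj M) ↔ S (stalk M) :=
  derivedPreimage_obj_iff S (BoundedDerivedCategory.stalk M)

/-- A short exact sequence of objects gives a distinguished triangle of stalk complexes, so that
the objects whose stalk complex is in a thick subcategory form a thick class. -/
theorem isThickInAbelian_stalk (S : ObjectProperty (SingularityCategory C)) [S.IsTriangulated]
    [S.IsStableUnderRetracts] :
    ObjectProperty.IsThickInAbelian (C := C) fun M => S (stalk M) where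
  of_retract {X Y} r hY := by
    have r' : Retract (BoundedDerivedCategory.stalk X) (BoundedDerivedCategory.stalk Y) :=
      { i := ObjectProperty.homMk ((singleFunctor C 0).map r.i)
        r := ObjectProperty.homMk ((singleFunctor C 0).map r.r)
        retract := (TStructure.t (C := C)).bounded.ι.map_injective
          ((r.map (singleFunctor C 0)).retract) }
    exact S.prop_of_retract (r'.map (boundedPerfectComplexes C).trW.Q) hY
  of_shortExact₁ hS h₂ h₃ := by
    rw [← derivedPreimage_single_iff S] at h₂ h₃ ⊢
    exact (derivedPreimage S).ext_of_isTriangulatedClosed₁ _ hS.singleTriangle_distinguished h₂ h₃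
  of_shortExact₂ hS h₂ h₃ := by
    rw [← derivedPreimage_single_iff S] at h₂ h₃ ⊢
    exact (derivedPreimage S).ext_of_isTriangulatedClosed₂ _ hS.singleTriangle_distinguished h₂ h₃
  of_shortExact₃ hS h₂ h₃ := by
    rw [← derivedPreimage_single_iff S] at h₂ h₃ ⊢
    exact (derivedPreimage S).ext_of_isTriangulatedClosed₃ _ hS.singleTriangle_distinguished h₂ h₃

theorem isZero_stalk_of_projective (P : C) [Projective P] : IsZero (stalk P) := by
  refine isZero_trW_Q_obj (boundedPerfectComplexes C)
    ⟨(HomologicalComplex.single C (ComplexShape.up ℤ) 0).obj P, 0, 0, inferInstance, inferInstance,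
      fun n => ?_, ⟨(singleFunctorIsoCompQ C 0).app P⟩⟩
  by_cases hn : n = 0
  · subst hn
    exact Projective.of_iso (HomologicalComplex.singleObjXSelf _ 0 P).symm inferInstance
  · exact (HomologicalComplex.isZero_single_obj_X _ _ _ _ hn).projective

/-- The stalk complexes generate the singularity category as a triangulated category. -/
theorem eq_top_of_forall_stalk (S : ObjectProperty (SingularityCategory C)) [S.IsTriangulated]
    [S.IsClosedUnderIsomorphisms] (hS : ∀ M : C, S (stalk M)) : S = ⊤ := by
  have key : ∀ (d : ℕ) (K : CochainComplex C ℤ) (a b : ℤ) [K.IsStrictlyGE a] [K.IsStrictlyLE b],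
      b + 1 - a ≤ d → derivedPreimage S (Q.obj K) := by
    intro d
    induction d with
    | zero =>
      intro K a b _ _ hd
      have hz : IsZero K := by
        rw [IsZero.iff_id_eq_zero]
        ext i
        by_cases hi : i < a
        · exact (K.isZero_of_isStrictlyGE a i).eq_of_src _ _
        · exact (K.isZero_of_isStrictlyLE b i (by push_cast at hd; lia)).eq_of_src _ _
      exact (derivedPreimage S).prop_of_isZero (Q.map_isZero hz)
    | succ d ih =>
      intro K a b _ _ hd
      obtain ⟨K', i, g, δ, h₁, h₂, -, hT⟩ := exists_stupid_truncation_step K a b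
      refine (derivedPreimage S).ext_of_isTriangulatedClosed₂ _ hT
        (ih K' (a + 1) b (by push_cast at hd; lia)) ?_
      exact (derivedPreimage S).prop_of_iso
        (((singleFunctors C).shiftIso (-a) a 0 (by lia)).app (K.X a))
        ((derivedPreimage S).le_shift (-a) _ ((derivedPreimage_single_iff S _).2 (hS _)))
  ext X
  refine ⟨fun _ => trivial, fun _ => ?_⟩
  let e := (boundedPerfectComplexes C).trW.Q.objObjPreimageIso X
  obtain ⟨⟨a, ha⟩, ⟨b, hb⟩⟩ := ((boundedPerfectComplexes C).trW.Q.objPreimage X).property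
  obtain ⟨K, _, _, ⟨e'⟩⟩ := exists_iso_Q_obj_of_isGE_of_isLE
    ((boundedPerfectComplexes C).trW.Q.objPreimage X).obj a b
  refine S.prop_of_iso e ((derivedPreimage_obj_iff S _).1 ?_)
  exact (derivedPreimage S).prop_of_iso e'.symm (key (b + 1 - a).toNat K a b (by simp))

end SingularityCategory

/-! ### Silting objects as biproducts -/

section Coproduct

variable {D : Type*} [Category* D]

/-- The coproduct of a sequence of objects, almost all of which are zero, is a finite biproduct. -/
theorem exists_isColimit_cofan_of_isZero [Preadditive D] [HasFiniteBiproducts D]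
    (X : ℕ → D) (c : ℕ) (hX : ∀ i, c ≤ i → IsZero (X i)) :
    ∃ ι : ∀ i, X i ⟶ ⨁ fun j : Fin c => X j, Nonempty (IsColimit (Cofan.mk _ ι)) := by
  refine ⟨fun i => if h : i < c then biproduct.ι (fun j : Fin c => X j) ⟨i, h⟩ else 0,
    ⟨Cofan.IsColimit.mk _ (fun s => biproduct.desc fun j => s.inj j) (fun s i => ?_)
      (fun s m hm => biproduct.hom_ext' _ _ fun j => ?_)⟩⟩
  · by_cases h : i < c
    · simp [h]
    · exact (hX i (by lia)).eq_of_src _ _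
  · have := hm j
    simpa using this

theorem isSilting_biproduct [HasZeroObject D] [HasShift D ℤ] [Preadditive D]
    [∀ n : ℤ, (shiftFunctor D n).Additive] [Pretriangulated D] [HasFiniteBiproducts D]
    {J : Type} [Finite J] (X : J → D)
    (h₁ : ∀ i j (m : ℤ), 0 < m → ∀ f : X i ⟶ (X j)⟦m⟧, f = 0)
    (h₂ : ∀ S : ObjectProperty D, S.IsTriangulated → S.IsStableUnderRetracts →
      (∀ j, S (X j)) → S = ⊤) [IsTriangulated D] : IsSilting (⨁ X) where
  hom_eq_zero m hm f := by
    have := Fintype.ofFinite J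
    refine biproduct.hom_ext' _ _ fun i => ?_
    have h : ∀ g : X i ⟶ (⨁ X)⟦m⟧, g = 0 := fun g => by
      rw [← Category.comp_id g, ← (shiftFunctor D m).map_id, ← biproduct.total, Functor.map_sum,
        Preadditive.comp_sum]
      refine Finset.sum_eq_zero fun j _ => ?_
      rw [Functor.map_comp, ← Category.assoc, h₁ i j m hm (g ≫ (biproduct.π X j)⟦m⟧'), zero_comp]
    rw [h (biproduct.ι X i ≫ f), comp_zero]
  thick_eq_top := by
    refine h₂ _ inferInstance inferInstance fun j => ?_
    refine ObjectProperty.prop_of_retract _ (Y := ⨁ X)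
      { i := biproduct.ι X j, r := biproduct.π X j } ?_
    exact ObjectProperty.le_triangEnvelope _ _ (ObjectProperty.singleton_iff _ _ |>.2 rfl)

end Coproduct

/-! ### Exactness, projectives and supports in the category of graded modules -/

namespace GrMod

variable {k A : Type u} [Field k] [Ring A] [Algebra k A] {𝒜 : ℤ → Submodule k A}

section Exactness

theorem mono_of_injective {X Y : GrMod 𝒜} (f : X ⟶ Y) (hf : Function.Injective (lin f)) :
    Mono f where
  right_cancellation _ _ w := hom_ext (LinearMap.ext fun z =>
    hf (LinearMap.congr_fun (congrArg lin w) z))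

theorem epi_of_surjective {X Y : GrMod 𝒜} (f : X ⟶ Y) (hf : Function.Surjective (lin f)) :
    Epi f where
  left_cancellation _ _ w := hom_ext (LinearMap.ext fun z => by
    obtain ⟨x, rfl⟩ := hf z
    exact LinearMap.congr_fun (congrArg lin w) x)

variable [Module.Finite k A]

/-- Exactness in `mod^ℤ A` can be checked on elements. -/
theorem shortExact_of_exact {S : ShortComplex (GrMod 𝒜)} (hf : Function.Injective (lin S.f))
    (hg : Function.Surjective (lin S.g))
    (h : ∀ x, lin S.g x = 0 → x ∈ LinearMap.range (lin S.f)) : S.ShortExact where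
  mono_f := mono_of_injective _ hf
  epi_g := epi_of_surjective _ hg
  exact := by
    have hw : ∀ {Z : GrMod 𝒜} (z : Z ⟶ S.X₂), z ≫ S.g = 0 →
        z ≫ S.X₂.quotπ _ (range_isHomog S.f) = 0 := fun z hz =>
      hom_ext (LinearMap.ext fun y =>
        (Submodule.Quotient.mk_eq_zero _).2 (h _ (lin_apply_eq_zero hz y)))
    have := mono_of_injective _ hf
    exact ShortComplex.exact_of_f_is_kernel S (KernelFork.IsLimit.ofι _ _
      (fun z hz => (monoIsLimit S.f hf).lift (KernelFork.ofι z (hw z hz)))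
      (fun z hz => (monoIsLimit S.f hf).fac (KernelFork.ofι z (hw z hz)) WalkingParallelPair.zero)
      (fun z hz m hm => by
        rw [← cancel_mono S.f, hm]
        exact ((monoIsLimit S.f hf).fac (KernelFork.ofι z (hw z hz))
          WalkingParallelPair.zero).symm))

theorem exact_of_shortExact {S : ShortComplex (GrMod 𝒜)} (hS : S.ShortExact) (x : S.X₂)
    (hx : lin S.g x = 0) : x ∈ LinearMap.range (lin S.f) := by
  have := hS.mono_f
  let z := hS.exact.lift (S.X₂.subι _ (ker_isHomog S.g)) (hom_ext (LinearMap.ext fun y => y.2))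
  have hz : z ≫ S.f = S.X₂.subι _ (ker_isHomog S.g) := hS.exact.lift_f _ _
  exact ⟨lin z ⟨x, hx⟩, LinearMap.congr_fun (congrArg lin hz) ⟨x, hx⟩⟩

/-- The short exact sequence of a surjective morphism. -/
theorem shortExact_kernel {X Y : GrMod 𝒜} (g : X ⟶ Y) (hg : Function.Surjective (lin g)) :
    (ShortComplex.mk (X.subι _ (ker_isHomog g)) g
      (hom_ext (LinearMap.ext fun x => x.2))).ShortExact :=
  shortExact_of_exact (fun _ _ h => Subtype.ext h) hg fun x hx => ⟨⟨x, hx⟩, rfl⟩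

/-- The short exact sequence of an injective morphism. -/
theorem shortExact_cokernel {X Y : GrMod 𝒜} (f : X ⟶ Y) (hf : Function.Injective (lin f)) :
    (ShortComplex.mk f (Y.quotπ _ (range_isHomog f)) (hom_ext (LinearMap.ext fun x =>
      (Submodule.Quotient.mk_eq_zero _).2 ⟨x, rfl⟩))).ShortExact :=
  shortExact_of_exact hf (Submodule.mkQ_surjective _)
    fun _ hx => (Submodule.Quotient.mk_eq_zero _).1 hx

/-- A short exact sequence of graded modules is exact as a sequence of modules. -/
theorem exists_shortExact_forget {S : ShortComplex (GrMod 𝒜)} (hS : S.ShortExact) :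
    ∃ w, (ShortComplex.mk (ModuleCat.ofHom (lin S.f)) (ModuleCat.ofHom (lin S.g)) w).ShortExact :=
  have w : ModuleCat.ofHom (lin S.f) ≫ ModuleCat.ofHom (lin S.g) = 0 :=
    ModuleCat.hom_ext (LinearMap.ext fun x => lin_apply_eq_zero S.zero x)
  ⟨w, {
    mono_f := (ModuleCat.mono_iff_injective _).2 (have := hS.mono_f; injective_of_mono S.f)
    epi_g := (ModuleCat.epi_iff_surjective _).2 (have := hS.epi_g; surjective_of_epi S.g)
    exact := (ShortComplex.moduleCat_exact_iff _).2 fun x hx => exact_of_shortExact hS x hx }⟩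

end Exactness

section Homogeneous

theorem comp_eq_zero_of_deg_eq_bot (X : GrMod 𝒜) {i : ℤ} (hi : X.deg i = ⊥) (x : X) :
    X.comp i x = 0 := by
  have := X.comp_mem i x
  rwa [hi] at this

variable [GradedAlgebra 𝒜]

omit [GradedAlgebra 𝒜] in
theorem comp_smul (X : GrMod 𝒜) {l : ℤ} {a : A} (ha : a ∈ 𝒜 l) (j : ℤ) (x : X) :
    X.comp (l + j) (a • x) = a • X.comp j x := by
  obtain ⟨s, hs⟩ := X.exists_sum x
  have key : ∀ i, X.comp (l + j) (a • X.comp i x) = a • X.comp j (X.comp i x) := fun i => by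
    have h : a • X.comp i x ∈ X.deg (l + i) :=
      SetLike.GradedSMul.smul_mem (A := 𝒜) (B := X.deg) ha (X.comp_mem i x)
    by_cases hij : i = j
    · subst hij
      rw [X.comp_same h, X.comp_same (X.comp_mem _ _)]
    · rw [X.comp_ne h (by simpa using hij), X.comp_ne (X.comp_mem _ _) hij, smul_zero]
  conv_lhs => rw [← hs]
  conv_rhs => rw [← hs]
  simp only [map_sum, Finset.smul_sum, key]

/-- An additive map is `A`-linear if it is so on homogeneous elements. -/
theorem map_smul_of_homogeneous {X : GrMod 𝒜} {Y : Type*} [AddCommGroup Y] [Module A Y]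
    (f : X →+ Y) (h : ∀ l, ∀ a ∈ 𝒜 l, ∀ j, ∀ x ∈ X.deg j, f (a • x) = a • f x) (a : A) (x : X) :
    f (a • x) = a • f x := by
  classical
  rw [← DirectSum.sum_support_decompose 𝒜 a, Finset.sum_smul, map_sum, Finset.sum_smul]
  refine Finset.sum_congr rfl fun l _ => ?_
  obtain ⟨s, hs⟩ := X.exists_sum x
  rw [← hs, Finset.smul_sum, map_sum, map_sum, Finset.smul_sum]
  exact Finset.sum_congr rfl fun j _ => h l _ (SetLike.coe_mem _) j _ (X.comp_mem j x)

/-- The degree zero part of a linear map between graded modules, i.e. the morphism given on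
`X.deg j` by the component of degree `j` of `f`. -/
theorem exists_hom_of_linearMap {X Y : GrMod 𝒜} (f : X →ₗ[A] Y) :
    ∃ g : X ⟶ Y, ∀ j, ∀ x ∈ X.deg j, lin g x = Y.comp j (f x) := by
  classical
  let dec := X.isInternal.chooseDecomposition
  let φ : X →+ Y := (DirectSum.toAddMonoid fun j =>
    (Y.comp j).comp (f.toAddMonoidHom.comp (X.deg j).subtype)).comp
      (DirectSum.decomposeAddEquiv X.deg).toAddMonoidHom
  have hφ : ∀ j, ∀ x ∈ X.deg j, φ x = Y.comp j (f x) := fun j x hx => by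
    lift x to X.deg j using hx
    change DirectSum.toAddMonoid _ (DirectSum.decompose X.deg (x : X)) = _
    rw [DirectSum.decompose_coe, DirectSum.toAddMonoid_of]
    rfl
  refine ⟨mkHom { φ with map_smul' := map_smul_of_homogeneous φ fun l a ha j x hx => ?_ }
    fun j x hx => ?_, hφ⟩
  · rw [hφ _ _ hx, hφ (l + j) _ (SetLike.GradedSMul.smul_mem (A := 𝒜) (B := X.deg) ha hx),
      map_smul, Y.comp_smul ha]
  · change φ x ∈ _
    rw [hφ j x hx]
    exact Y.comp_mem _ _

omit [GradedAlgebra 𝒜] in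
theorem linearMap_eq_of_homogeneous {X : GrMod 𝒜} {Y : Type*} [AddCommGroup Y]
    (f g : X →+ Y) (h : ∀ j, ∀ x ∈ X.deg j, f x = g x) : f = g := by
  ext x
  obtain ⟨s, hs⟩ := X.exists_sum x
  rw [← hs, map_sum, map_sum]
  exact Finset.sum_congr rfl fun j _ => h j _ (X.comp_mem j x)

/-- If a morphism extends along `i` to an `A`-linear map, it extends to a morphism. -/
theorem exists_extension {X Y Z : GrMod 𝒜} (i : X ⟶ Y) (f : X ⟶ Z) (g : Y →ₗ[A] Z)
    (h : g ∘ₗ lin i = lin f) : ∃ g' : Y ⟶ Z, i ≫ g' = f := by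
  obtain ⟨g', hg'⟩ := exists_hom_of_linearMap g
  refine ⟨g', hom_ext (LinearMap.toAddMonoidHom_injective
    (linearMap_eq_of_homogeneous _ _ fun j x hx => ?_))⟩
  change lin g' (lin i x) = lin f x
  rw [hg' j _ (lin_map i hx), ← LinearMap.comp_apply, h, Z.comp_same (lin_map f hx)]

/-- If a morphism lifts along `p` to an `A`-linear map, it lifts to a morphism. -/
theorem exists_lift {X Y Z : GrMod 𝒜} (p : Y ⟶ Z) (f : X ⟶ Z) (g : X →ₗ[A] Y)
    (h : lin p ∘ₗ g = lin f) : ∃ g' : X ⟶ Y, g' ≫ p = f := by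
  obtain ⟨g', hg'⟩ := exists_hom_of_linearMap g
  refine ⟨g', hom_ext (LinearMap.toAddMonoidHom_injective
    (linearMap_eq_of_homogeneous _ _ fun j x hx => ?_))⟩
  change lin p (lin g' x) = lin f x
  rw [hg' j _ hx, lin_comp_apply, ← LinearMap.comp_apply, h, Z.comp_same (lin_map f hx)]

/-- A graded module which is projective as a module is a projective object. -/
theorem projective_of_moduleProjective [Module.Finite k A] (X : GrMod 𝒜) [Module.Projective A X] :
    Projective X where
  factors f e _ := by
    obtain ⟨g, hg⟩ := Module.projective_lifting_property (lin e) (lin f) (surjective_of_epi e)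
    exact exists_lift e f g hg

end Homogeneous

section Support

/-- The action of `k` on a graded module, by restriction of scalars along `k → A`. -/
@[reducible] def moduleBase (X : GrMod 𝒜) : Module k X := Module.compHom X (algebraMap k A)

theorem isScalarTower_base (X : GrMod 𝒜) :
    letI := X.moduleBase
    IsScalarTower k A X :=
  letI := X.moduleBase
  IsScalarTower.of_algebraMap_smul fun _ _ => rfl

theorem finite_base [Module.Finite k A] (X : GrMod 𝒜) :
    letI := X.moduleBase
    Module.Finite k X :=
  letI := X.moduleBase
  have := X.isScalarTower_base
  Module.Finite.trans A X

variable [GradedAlgebra 𝒜]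

/-- The homogeneous components as subspaces. -/
def degSubmodule (X : GrMod 𝒜) (i : ℤ) :
    letI := X.moduleBase
    Submodule k X :=
  letI := X.moduleBase
  { X.deg i with
    smul_mem' c x hx := by
      have h := SetLike.GradedSMul.smul_mem (A := 𝒜) (B := X.deg)
        (SetLike.algebraMap_mem_graded 𝒜 c) hx
      rwa [zero_vadd] at h }

theorem finite_support [Module.Finite k A] (X : GrMod 𝒜) : {i | X.deg i ≠ ⊥}.Finite := by
  let := X.moduleBase
  have := X.finite_base
  have h : DirectSum.IsInternal X.degSubmodule := X.isInternal
  refine (WellFoundedGT.finite_ne_bot_of_iSupIndep h.submodule_iSupIndep).subset fun i hi hi' =>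
    hi ?_
  rw [AddSubgroup.eq_bot_iff_forall]
  intro x hx
  have : x ∈ X.degSubmodule i := hx
  rwa [hi'] at this

theorem exists_lower_bound [Module.Finite k A] (X : GrMod 𝒜) : ∃ a, ∀ i < a, X.deg i = ⊥ := by
  obtain ⟨a, ha⟩ := X.finite_support.bddBelow
  exact ⟨a, fun i hi => by_contra fun h => absurd (ha h) (by lia)⟩

theorem exists_upper_bound [Module.Finite k A] (X : GrMod 𝒜) : ∃ b, ∀ i, b < i → X.deg i = ⊥ := by
  obtain ⟨a, ha⟩ := X.finite_support.bddAbove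
  exact ⟨a, fun i hi => by_contra fun h => absurd (ha h) (by lia)⟩

omit [GradedAlgebra 𝒜] in
theorem isZero_of_deg_eq_bot (X : GrMod 𝒜) (h : ∀ i, X.deg i = ⊥) : IsZero X := by
  rw [IsZero.iff_id_eq_zero]
  refine hom_ext (LinearMap.ext fun x => ?_)
  obtain ⟨s, hs⟩ := X.exists_sum x
  change x = 0
  rw [← hs]
  exact Finset.sum_eq_zero fun i _ => X.comp_eq_zero_of_deg_eq_bot (h i) x

end Support

section Cover

variable [GradedAlgebra 𝒜]

/-- The morphism `A(n) ⟶ X` which sends `1` to `x`. -/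
def ofElem (X : GrMod 𝒜) (n : ℤ) (x : X) (hx : x ∈ X.deg (-n)) : (regular 𝒜).shift n ⟶ X :=
  mkHom (LinearMap.toSpanSingleton A X x) fun i a ha => by
    have h (b : A) (hb : b ∈ 𝒜 (n + i)) : b • x ∈ X.deg i := by
      have := SetLike.GradedSMul.smul_mem (A := 𝒜) (B := X.deg) hb hx
      rwa [vadd_eq_add, add_assoc, add_neg_cancel_comm_assoc] at this
    exact h a ha

/-- A class `F` of graded modules which is closed under finite direct sums and contains `A(n)` for
all `n` such that `M` has a nonzero component of degree `-n` contains a module mapping onto `M`. -/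
theorem exists_surjection (M : GrMod 𝒜) (F : GrMod 𝒜 → Prop) (h₀ : F (zero 𝒜))
    (hprod : ∀ X Y, F X → F Y → F (prod X Y))
    (hF : ∀ n, M.deg (-n) ≠ ⊥ → F ((regular 𝒜).shift n)) :
    ∃ (P : GrMod 𝒜) (f : P ⟶ M), F P ∧ Function.Surjective (lin f) := by
  classical
  have key : ∀ s : Finset (M × ℤ), (∀ p ∈ s, p.1 ∈ M.deg p.2) →
      ∃ (P : GrMod 𝒜) (f : P ⟶ M), F P ∧ ∀ p ∈ s, p.1 ∈ LinearMap.range (lin f) := by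
    intro s
    induction s using Finset.induction_on with
    | empty => exact fun _ => ⟨zero 𝒜, 0, h₀, by simp⟩
    | insert p s _ ih =>
      intro hs
      obtain ⟨P, f, hP, hf⟩ := ih fun q hq => hs q (Finset.mem_insert_of_mem hq)
      by_cases hp : p.1 = 0
      · refine ⟨P, f, hP, fun q hq => ?_⟩
        obtain rfl | hq := Finset.mem_insert.1 hq
        · rw [hp]
          exact zero_mem _
        · exact hf q hq
      have hp' : p.1 ∈ M.deg (- -p.2) := by
        rw [neg_neg]
        exact hs p (Finset.mem_insert_self _ _)
      let g := M.ofElem (-p.2) p.1 hp'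
      refine ⟨prod P ((regular 𝒜).shift (-p.2)), mkHom ((lin f).coprod (lin g))
        fun i x hx => add_mem (lin_map f hx.1) (lin_map g hx.2), hprod _ _ hP (hF _ ?_),
        fun q hq => ?_⟩
      · intro hbot
        rw [hbot] at hp'
        exact hp hp'
      obtain rfl | hq := Finset.mem_insert.1 hq
      · refine ⟨((0 : P), (1 : A)), ?_⟩
        change lin f 0 + (1 : A) • q.1 = q.1
        rw [map_zero, one_smul, zero_add]
      · obtain ⟨y, hy⟩ := hf q hq
        refine ⟨(y, (0 : A)), ?_⟩
        change lin f y + (0 : A) • p.1 = q.1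
        rw [hy, zero_smul, add_zero]
  obtain ⟨t, ht⟩ := Module.finite_def.1 M.finite
  choose c hc using M.exists_sum
  obtain ⟨P, f, hP, hf⟩ := key (t.biUnion fun x => (c x).image fun i => (M.comp i x, i)) (by
    intro p hp
    simp only [Finset.mem_biUnion, Finset.mem_image] at hp
    obtain ⟨x, -, i, -, rfl⟩ := hp
    exact M.comp_mem i x)
  refine ⟨P, f, hP, ?_⟩
  rw [← LinearMap.range_eq_top, eq_top_iff, ← ht, Submodule.span_le]
  intro x hx
  rw [← hc x]
  refine sum_mem fun i hi => hf (M.comp i x, i) ?_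
  simp only [Finset.mem_biUnion, Finset.mem_image]
  exact ⟨x, hx, i, hi, rfl⟩

/-- Every graded module is a quotient of a graded module which is projective as a module. -/
theorem exists_projective_surjection (M : GrMod 𝒜) :
    ∃ (P : GrMod 𝒜) (f : P ⟶ M), Module.Projective A P ∧ Function.Surjective (lin f) :=
  exists_surjection M (fun P => Module.Projective A P)
    (inferInstanceAs (Module.Projective A PUnit.{u + 1}))
    (fun X Y (_ : Module.Projective A X) (_ : Module.Projective A Y) =>
      inferInstanceAs (Module.Projective A (X × Y)))
    (fun _ _ => inferInstanceAs (Module.Projective A A))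

instance [Module.Finite k A] : EnoughProjectives (GrMod 𝒜) where
  presentation M := by
    obtain ⟨P, f, hP, hf⟩ := exists_projective_surjection M
    exact ⟨{ p := P, projective := projective_of_moduleProjective P, f := f,
             epi := epi_of_surjective f hf }⟩

end Cover

end GrMod

/-! ### Injective dimension and vanishing of extensions -/

namespace GrMod

variable {k A : Type u} [Field k] [Ring A] [Algebra k A] {𝒜 : ℤ → Submodule k A}
  [Module.Finite k A] [GradedAlgebra 𝒜]

section InjectiveDimension

open Abelian

/-- A graded module which has injective dimension at most one as a module also has injective
dimension at most one as a graded module: a class in `Ext²` of graded modules is represented by a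
morphism from a second syzygy `K' ⊆ F'`, and this morphism extends to `F'` because it does so
as an `A`-linear map. -/
theorem hasInjectiveDimensionLT_two (X : GrMod 𝒜) [HasInjectiveDimensionLT (ModuleCat.of A X) 2] :
    HasInjectiveDimensionLT X 2 := by
  let := HasExt.standard (GrMod 𝒜)
  let := HasExt.standard (ModuleCat.{u} A)
  refine hasInjectiveDimensionLT_of_enoughProjectives X 2 fun Y => ⟨fun e e' => ?_⟩
  suffices h : ∀ e : Ext Y X 2, e = 0 by rw [h e, h e']
  clear e e'
  intro e
  obtain ⟨F, p, hF, hp⟩ := exists_projective_surjection Y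
  have := projective_of_moduleProjective F
  have hS := shortExact_kernel p hp
  obtain ⟨F', q, hF', hq⟩ := exists_projective_surjection (F.sub _ (ker_isHomog p))
  have := projective_of_moduleProjective F'
  have hS' := shortExact_kernel q hq
  obtain ⟨e₁, rfl⟩ := Ext.contravariant_sequence_exact₃ hS X e (Ext.eq_zero_of_projective _)
    (add_comm 1 1)
  obtain ⟨e₀, rfl⟩ := Ext.contravariant_sequence_exact₃ hS' X e₁ (Ext.eq_zero_of_projective _)
    (add_zero 1)
  obtain ⟨φ, rfl⟩ := Ext.mk₀_bijective _ _ |>.2 e₀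
  -- the same sequences of modules, where the obstruction to extending `φ` to `F'` vanishes
  obtain ⟨w, hT⟩ := exists_shortExact_forget hS
  obtain ⟨w', hT'⟩ := exists_shortExact_forget hS'
  have hFp : Projective (ModuleCat.of A F) := (IsProjective.iff_projective _).1 hF
  have h₁ : ∀ e : Ext (ModuleCat.of A (F.sub _ (ker_isHomog p))) (ModuleCat.of A X) 1, e = 0 := by
    intro e
    obtain ⟨e', rfl⟩ := Ext.contravariant_sequence_exact₁ hT _ e rfl
      (Ext.eq_zero_of_hasInjectiveDimensionLT _ 2 le_rfl)
    have : e' = 0 := Ext.eq_zero_of_projective e'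
    rw [this, Ext.comp_zero]
  obtain ⟨e₀, he₀⟩ := Ext.contravariant_sequence_exact₁ hT' _
    (Ext.mk₀ (ModuleCat.ofHom (lin φ))) (add_zero 1) (h₁ _)
  obtain ⟨g, rfl⟩ := Ext.mk₀_bijective _ _ |>.2 e₀
  rw [Ext.mk₀_comp_mk₀] at he₀
  have hg := Ext.mk₀_bijective _ _ |>.1 he₀
  obtain ⟨g', hg'⟩ := exists_extension (F'.subι _ (ker_isHomog q)) φ g.hom
    (congrArg ModuleCat.Hom.hom hg)
  have h₀ : hS'.extClass.comp (Ext.mk₀ φ) (add_zero 1) = 0 := by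
    rw [← hg', ← Ext.mk₀_comp_mk₀, ShortComplex.ShortExact.extClass_comp_assoc]
  rw [h₀, Ext.comp_zero]

/-- If `A` has injective dimension at most one as a left module, so has every projective graded
module, as a direct summand of a finite direct sum of modules `A(n)`. -/
theorem hasInjectiveDimensionLT_two_of_projective
    (hA : HasInjectiveDimensionLE (ModuleCat.of A A) 1) (P : GrMod 𝒜) [Projective P] :
    HasInjectiveDimensionLT P 2 := by
  obtain ⟨F, f, hF, hf⟩ := exists_surjection P
    (fun F => HasInjectiveDimensionLT (ModuleCat.of A F) 2)
    (by
      have h : IsZero (ModuleCat.of A PUnit.{u + 1}) := ModuleCat.isZero_of_subsingleton _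
      have := h.hasInjectiveDimensionLT_zero
      exact hasInjectiveDimensionLT_of_ge (ModuleCat.of A PUnit.{u + 1}) 0 2 (by lia))
    (fun X Y _ _ => hasInjectiveDimensionLT_of_iso
      (ModuleCat.biprodIsoProd (ModuleCat.of A X) (ModuleCat.of A Y)) 2)
    (fun _ _ => hA)
  have := hasInjectiveDimensionLT_two F
  have := epi_of_surjective f hf
  have r : Retract P F :=
    { i := Projective.factorThru (𝟙 P) f, r := f, retract := Projective.factorThru_comp _ _ }
  exact r.hasInjectiveDimensionLT 2

end InjectiveDimension

section Degrees

open Abelian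

omit [GradedAlgebra 𝒜] in
theorem deg_sub_eq_bot {X : GrMod 𝒜} {S : Submodule A X} (hS : X.IsHomog S) {i : ℤ}
    (h : ∀ x ∈ X.deg i, x ∈ S → x = 0) : (X.sub S hS).deg i = ⊥ :=
  (AddSubgroup.eq_bot_iff_forall _).2 fun x hx => Subtype.ext (h x.1 hx x.2)

omit [Module.Finite k A] [GradedAlgebra 𝒜] in
theorem deg_quot_eq_bot {X : GrMod 𝒜} {S : Submodule A X} (hS : X.IsHomog S) {i : ℤ}
    (h : ∀ x ∈ X.deg i, x ∈ S) : (X.quot S hS).deg i = ⊥ :=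
  (AddSubgroup.eq_bot_iff_forall _).2 (by
    rintro _ ⟨x, hx, rfl⟩
    exact (Submodule.Quotient.mk_eq_zero _).2 (h x hx))

omit [Module.Finite k A] in
theorem deg_regular_shift_eq_bot (hpos : ∀ i < 0, 𝒜 i = ⊥) {n i : ℤ} (h : n + i < 0) :
    ((regular 𝒜).shift n).deg i = ⊥ := by
  change (𝒜 (n + i)).toAddSubgroup = ⊥
  rw [hpos _ h]
  rfl

omit [Module.Finite k A] [GradedAlgebra 𝒜] in
theorem hom_eq_zero_of_deg {U N : GrMod 𝒜} (h : ∀ i, U.deg i = ⊥ ∨ N.deg i = ⊥) (f : U ⟶ N) :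
    f = 0 := by
  refine hom_ext (LinearMap.toAddMonoidHom_injective
    (linearMap_eq_of_homogeneous _ _ fun i x hx => ?_))
  change lin f x = 0
  obtain hi | hi := h i
  · rw [hi] at hx
    rw [(AddSubgroup.mem_bot.1 hx), map_zero]
  · have := lin_map f hx
    rwa [hi] at this

/-- Over a positively graded algebra, there are no extensions of a module in degrees `≥ a` by
a module in degrees `< a`: the former has a projective resolution in degrees `≥ a`. -/
theorem ext_eq_zero_of_deg [HasExt.{w} (GrMod 𝒜)] (hpos : ∀ i < 0, 𝒜 i = ⊥) {U N : GrMod 𝒜}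
    (a : ℤ)
    (hU : ∀ i < a, U.deg i = ⊥) (hN : ∀ i, a ≤ i → N.deg i = ⊥) (n : ℕ) (e : Ext U N n) :
    e = 0 := by
  induction n generalizing U with
  | zero =>
    obtain ⟨f, rfl⟩ := (Ext.mk₀_bijective _ _).2 e
    rw [hom_eq_zero_of_deg (fun i => ?_) f, Ext.mk₀_zero]
    by_cases hi : i < a
    · exact .inl (hU i hi)
    · exact .inr (hN i (by lia))
  | succ n ih =>
    obtain ⟨P, f, ⟨hP, hP'⟩, hf⟩ := exists_surjection U
      (fun P => Module.Projective A P ∧ ∀ i < a, P.deg i = ⊥)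
      ⟨inferInstanceAs (Module.Projective A PUnit.{u + 1}), fun i _ =>
        (AddSubgroup.eq_bot_iff_forall _).2 fun _ _ => rfl⟩
      (fun X Y hX hY => ⟨have := hX.1; have := hY.1; inferInstanceAs (Module.Projective A (X × Y)),
        fun i hi => by
          change (X.deg i).prod (Y.deg i) = ⊥
          rw [hX.2 i hi, hY.2 i hi, AddSubgroup.bot_prod_bot]⟩)
      (fun n hn => ⟨inferInstanceAs (Module.Projective A A), fun i hi =>
        deg_regular_shift_eq_bot hpos (by
          by_contra h
          exact hn (hU (-n) (by lia)))⟩)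
    have := projective_of_moduleProjective P
    obtain ⟨e', rfl⟩ := Ext.contravariant_sequence_exact₃ (shortExact_kernel f hf) N e
      (Ext.eq_zero_of_projective _) (add_comm 1 n)
    have hK : ∀ i < a, (P.sub _ (ker_isHomog f)).deg i = ⊥ := fun i hi =>
      deg_sub_eq_bot _ fun x hx _ => by
        rw [hP' i hi] at hx
        exact hx
    rw [ih hK e', Ext.comp_zero]

/-- The modules `A(i)_{≤ 0}` have no extensions of positive degree by each other. -/
theorem ext_shiftTrunc_eq_zero [HasExt.{w} (GrMod 𝒜)] (hpos : ∀ i < 0, 𝒜 i = ⊥) (i j : ℤ)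
    (m : ℕ) (hm : 1 ≤ m)
    (e : Ext (((regular 𝒜).shift i).truncLE 0) (((regular 𝒜).shift j).truncLE 0) m) : e = 0 := by
  obtain ⟨m, rfl⟩ := Nat.exists_eq_add_of_le' hm
  have := @projective_of_moduleProjective k A _ _ _ 𝒜 _ _ ((regular 𝒜).shift i)
    (inferInstanceAs (Module.Projective A A))
  let X := (regular 𝒜).shift i
  have hS : (ShortComplex.mk (X.subι (X.geSubmodule 1) (X.geSubmodule_isHomog 1))
      (X.quotπ (X.geSubmodule 1) (X.geSubmodule_isHomog 1)) (hom_ext (LinearMap.ext fun x =>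
      (Submodule.Quotient.mk_eq_zero _).2 x.2))).ShortExact :=
    shortExact_of_exact (fun _ _ h => Subtype.ext h) (Submodule.mkQ_surjective _)
      fun x hx => ⟨⟨x, (Submodule.Quotient.mk_eq_zero _).1 hx⟩, rfl⟩
  obtain ⟨e', rfl⟩ := Ext.contravariant_sequence_exact₃ hS _ e
      (Ext.eq_zero_of_projective _) (add_comm 1 m)
  have h₁ : ∀ l < 1, (X.sub (X.geSubmodule 1) (X.geSubmodule_isHomog 1)).deg l = ⊥ :=
    fun l hl => deg_sub_eq_bot _ fun x hx hx' => by
      rw [← X.comp_same hx]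
      exact (mem_geSubmodule_iff hpos X 1 x).1 hx' l hl
  have h₂ : ∀ l, 1 ≤ l → (((regular 𝒜).shift j).truncLE 0).deg l = ⊥ :=
    fun l hl => deg_quot_eq_bot _ fun x hx => Submodule.subset_span ⟨l, hl, hx⟩
  rw [ext_eq_zero_of_deg hpos 1 h₁ h₂ m e']
  exact Ext.comp_zero _ _ _ _ _

end Degrees

end GrMod

/-! ### Duality for modules over a finite-dimensional algebra -/

section Duality

/-- The dual `Hom_k(M, k)` of a left `R`-module `M`, as a right `R`-module, i.e. as an
`Rᵐᵒᵖ`-module.  This is a type synonym, so that the dual of `R` can carry either structure. -/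
def OpDual (k M : Type*) [Field k] [AddCommGroup M] [Module k M] : Type _ := Module.Dual k M

/-- The dual `Hom_k(M, k)` of a right `R`-module `M`, as a left `R`-module.  The right
`R`-module is encoded as an `Rᵐᵒᵖ`-module. -/
def UnopDual (k M : Type*) [Field k] [AddCommGroup M] [Module k M] : Type _ := Module.Dual k M

variable {k R : Type*} [Field k] [Ring R] [Algebra k R]

section

variable (k) (M : Type*) [AddCommGroup M] [Module k M]

instance : AddCommGroup (OpDual k M) := inferInstanceAs (AddCommGroup (Module.Dual k M))
instance : Module k (OpDual k M) := inferInstanceAs (Module k (Module.Dual k M))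
instance : FunLike (OpDual k M) M k := inferInstanceAs (FunLike (Module.Dual k M) M k)
instance : LinearMapClass (OpDual k M) k M k :=
  inferInstanceAs (LinearMapClass (Module.Dual k M) k M k)
instance : AddCommGroup (UnopDual k M) := inferInstanceAs (AddCommGroup (Module.Dual k M))
instance : Module k (UnopDual k M) := inferInstanceAs (Module k (Module.Dual k M))
instance [Module.Finite k M] : Module.Finite k (UnopDual k M) :=
  inferInstanceAs (Module.Finite k (Module.Dual k M))
instance : FunLike (UnopDual k M) M k := inferInstanceAs (FunLike (Module.Dual k M) M k)
instance : LinearMapClass (UnopDual k M) k M k :=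
  inferInstanceAs (LinearMapClass (Module.Dual k M) k M k)

end

section

variable {M : Type*} [AddCommGroup M] [Module k M]

theorem OpDual.ext {f g : OpDual k M} (h : ∀ m, f m = g m) : f = g := LinearMap.ext h

theorem UnopDual.ext {f g : UnopDual k M} (h : ∀ m, f m = g m) : f = g := LinearMap.ext h

instance [Module R M] [IsScalarTower k R M] : Module Rᵐᵒᵖ (OpDual k M) where
  smul a f := LinearMap.comp (show Module.Dual k M from f) (Algebra.lsmul k k M a.unop)
  one_smul f := OpDual.ext fun m => congrArg f (one_smul R m)
  mul_smul a b f := OpDual.ext fun m => congrArg f (mul_smul b.unop a.unop m)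
  smul_zero _ := rfl
  smul_add _ _ _ := rfl
  add_smul a b f := OpDual.ext fun m =>
    (congrArg f (add_smul a.unop b.unop m)).trans (map_add f _ _)
  zero_smul f := OpDual.ext fun m => (congrArg f (zero_smul R m)).trans (map_zero f)

theorem OpDual.smul_apply [Module R M] [IsScalarTower k R M] (a : Rᵐᵒᵖ) (f : OpDual k M) (m : M) :
    (a • f) m = f (a.unop • m) := rfl

instance [Module Rᵐᵒᵖ M] [IsScalarTower k Rᵐᵒᵖ M] : Module R (UnopDual k M) where
  smul a f := LinearMap.comp (show Module.Dual k M from f)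
    (Algebra.lsmul k k M (MulOpposite.op a))
  one_smul f := UnopDual.ext fun m => congrArg f (one_smul Rᵐᵒᵖ m)
  mul_smul a b f := UnopDual.ext fun m =>
    congrArg f (mul_smul (MulOpposite.op b) (MulOpposite.op a) m)
  smul_zero _ := rfl
  smul_add _ _ _ := rfl
  add_smul a b f := UnopDual.ext fun m =>
    (congrArg f (add_smul (MulOpposite.op a) (MulOpposite.op b) m)).trans (map_add f _ _)
  zero_smul f := UnopDual.ext fun m => (congrArg f (zero_smul Rᵐᵒᵖ m)).trans (map_zero f)

instance [Module R M] [IsScalarTower k R M] : IsScalarTower k Rᵐᵒᵖ (OpDual k M) :=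
  IsScalarTower.of_algebraMap_smul fun c f => OpDual.ext fun m => by
    rw [OpDual.smul_apply, MulOpposite.algebraMap_apply, MulOpposite.unop_op, algebraMap_smul,
      map_smul]
    rfl

theorem UnopDual.smul_apply [Module Rᵐᵒᵖ M] [IsScalarTower k Rᵐᵒᵖ M] (a : R) (f : UnopDual k M)
    (m : M) : (a • f) m = f (MulOpposite.op a • m) := rfl

instance [Module Rᵐᵒᵖ M] [IsScalarTower k Rᵐᵒᵖ M] : IsScalarTower k R (UnopDual k M) :=
  IsScalarTower.of_algebraMap_smul fun c f => UnopDual.ext fun m => by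
    rw [UnopDual.smul_apply, ← MulOpposite.algebraMap_apply, algebraMap_smul, map_smul]
    rfl

end

/-- The transpose of a linear map. -/
def OpDual.map {M N : Type*} [AddCommGroup M] [Module k M] [Module R M] [IsScalarTower k R M]
    [AddCommGroup N] [Module k N] [Module R N] [IsScalarTower k R N] (f : M →ₗ[R] N) :
    OpDual k N →ₗ[Rᵐᵒᵖ] OpDual k M where
  toFun φ := (show Module.Dual k N from φ) ∘ₗ f.restrictScalars k
  map_add' _ _ := rfl
  map_smul' a φ := OpDual.ext fun m => congrArg φ (f.map_smul a.unop m).symm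

end Duality

section

variable {k R : Type u} [Field k] [Ring R] [Algebra k R]

/-- The dual of a projective left module is an injective right module. -/
theorem injective_opDual (P : Type u) [AddCommGroup P] [Module k P] [Module R P]
    [IsScalarTower k R P] [Module.Projective R P] :
    Injective (ModuleCat.of Rᵐᵒᵖ (OpDual k P)) where
  factors {M N} g f hf := by
    let : Module k M := Module.compHom M (algebraMap k Rᵐᵒᵖ)
    let : Module k N := Module.compHom N (algebraMap k Rᵐᵒᵖ)
    have : IsScalarTower k Rᵐᵒᵖ M := IsScalarTower.of_algebraMap_smul fun _ _ => rfl
    have : IsScalarTower k Rᵐᵒᵖ N := IsScalarTower.of_algebraMap_smul fun _ _ => rfl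
    have hf : Function.Injective (f.hom.restrictScalars k) := (ModuleCat.mono_iff_injective f).1 hf
    -- by adjunction, extending `g` to `N` amounts to lifting `ψ` along the transpose `p` of `f`
    let p : UnopDual k N →ₗ[R] UnopDual k M :=
      { toFun φ := (show Module.Dual k N from φ) ∘ₗ f.hom.restrictScalars k
        map_add' _ _ := rfl
        map_smul' a φ := UnopDual.ext fun m =>
          congrArg φ (f.hom.map_smul (MulOpposite.op a) m).symm }
    have hp : Function.Surjective p := LinearMap.dualMap_surjective_of_injective hf
    let ψ : P →ₗ[R] UnopDual k M :=
      { toFun x := (LinearMap.applyₗ (M := P) (M₂ := k) (R := k) x) ∘ₗ g.hom.restrictScalars k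
        map_add' x y := UnopDual.ext fun m => map_add (show OpDual k P from g.hom m) x y
        map_smul' a x := UnopDual.ext fun m =>
          (DFunLike.congr_fun (g.hom.map_smul (MulOpposite.op a) m) x).symm }
    obtain ⟨ψ', hψ'⟩ := Module.projective_lifting_property p ψ hp
    let g' : N →ₗ[Rᵐᵒᵖ] OpDual k P :=
      { toFun n := (LinearMap.applyₗ (M := N) (M₂ := k) (R := k) n) ∘ₗ ψ'.restrictScalars k
        map_add' n n' := OpDual.ext fun x => map_add (ψ' x) n n'
        map_smul' a n := OpDual.ext fun x =>
          (DFunLike.congr_fun (ψ'.map_smul a.unop x) n).symm }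
    refine ⟨ModuleCat.ofHom g', ModuleCat.hom_ext (LinearMap.ext fun m => OpDual.ext fun x => ?_)⟩
    have := LinearMap.congr_fun hψ' x
    have := DFunLike.congr_fun this m
    exact this

end

section

variable {k R : Type u} [Field k] [Ring R] [Algebra k R]

/-- The dual of the right module `R` is an injective left module; it is a cogenerator. -/
theorem injective_unopDual_self (k R : Type u) [Field k] [Ring R] [Algebra k R] :
    Injective (ModuleCat.of R (UnopDual k R)) where
  factors {M N} g f hf := by
    let : Module k M := Module.compHom M (algebraMap k R)
    let : Module k N := Module.compHom N (algebraMap k R)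
    have : IsScalarTower k R M := IsScalarTower.of_algebraMap_smul fun _ _ => rfl
    have : IsScalarTower k R N := IsScalarTower.of_algebraMap_smul fun _ _ => rfl
    have hf : Function.Injective (f.hom.restrictScalars k) := (ModuleCat.mono_iff_injective f).1 hf
    let φ : Module.Dual k M := LinearMap.applyₗ (M := R) (M₂ := k) (R := k) 1 ∘ₗ
      g.hom.restrictScalars k
    obtain ⟨ψ, hψ⟩ := LinearMap.dualMap_surjective_of_injective hf φ
    let g' : N →ₗ[R] UnopDual k R :=
      { toFun n := ψ ∘ₗ (LinearMap.toSpanSingleton R N n).restrictScalars k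
        map_add' n n' := UnopDual.ext fun r => by
          change ψ (r • (n + n')) = ψ (r • n) + ψ (r • n')
          rw [smul_add, map_add]
        map_smul' a n := UnopDual.ext fun r => congrArg ψ (mul_smul r a n).symm }
    refine ⟨ModuleCat.ofHom g', ModuleCat.hom_ext (LinearMap.ext fun m => UnopDual.ext fun r => ?_)⟩
    change ψ (r • f.hom m) = (show UnopDual k R from g.hom m) r
    rw [← map_smul]
    refine (LinearMap.congr_fun hψ (r • m)).trans ?_
    change (show UnopDual k R from g.hom (r • m)) 1 = _
    rw [map_smul]
    exact congrArg (show UnopDual k R from g.hom m) (one_mul r)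

/-- A finite-dimensional module whose dual is injective is projective.  The section of `Rⁿ → K` is
the transpose of a retraction of the dual map, read through the identification of a
finite-dimensional space with its bidual. -/
theorem projective_of_injective_opDual {K : Type u} [AddCommGroup K] [Module k K] [Module R K]
    [IsScalarTower k R K] [Module.Finite R K] [Module.Finite k R]
    [hK : Injective (ModuleCat.of Rᵐᵒᵖ (OpDual k K))] : Module.Projective R K := by
  obtain ⟨n, π, hπ⟩ := Module.Finite.exists_fin' R K
  have hmono : Mono (ModuleCat.ofHom (OpDual.map (k := k) π)) :=
    (ModuleCat.mono_iff_injective _).2 fun φ ψ h => OpDual.ext fun x => by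
      obtain ⟨y, rfl⟩ := hπ x
      exact DFunLike.congr_fun h y
  let r : OpDual k (Fin n → R) →ₗ[Rᵐᵒᵖ] OpDual k K :=
    (Injective.factorThru (𝟙 _) (ModuleCat.ofHom (OpDual.map (k := k) π))).hom
  have hr : ∀ φ, r (OpDual.map π φ) = φ := fun φ => LinearMap.congr_fun (congrArg ModuleCat.Hom.hom
    (Injective.comp_factorThru (𝟙 _) (ModuleCat.ofHom (OpDual.map (k := k) π)))) φ
  let ev := Module.evalEquiv k (Fin n → R)
  let s : K → (Fin n → R) := fun x => ev.symm
    (LinearMap.applyₗ (M := K) (M₂ := k) (R := k) x ∘ₗ r.restrictScalars k)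
  have hs : ∀ x (φ : OpDual k (Fin n → R)), φ (s x) = r φ x := fun x φ =>
    Module.apply_evalEquiv_symm_apply k (Fin n → R) φ _
  have hext : ∀ x y : Fin n → R, (∀ φ : OpDual k (Fin n → R), φ x = φ y) → x = y :=
    fun x y h => ev.injective (LinearMap.ext h)
  refine Module.Projective.of_split
    { toFun := s
      map_add' x y := hext _ _ fun φ => by rw [hs, map_add, map_add, hs, hs]
      map_smul' a x := hext _ _ fun φ => ?_ } π (LinearMap.ext fun x => ?_)
  · have h₁ : φ (a • s x) = (MulOpposite.op a • φ) (s x) := rfl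
    have h₂ : r φ (a • x) = (MulOpposite.op a • r φ) x := rfl
    rw [hs, RingHom.id_apply, h₁, hs, h₂, r.map_smul]
  · have := Module.Finite.trans (R := k) R K
    change π (s x) = x
    rw [← sub_eq_zero, ← Module.forall_dual_apply_eq_zero_iff k]
    intro χ
    rw [map_sub, sub_eq_zero]
    have := hs x (OpDual.map π (show OpDual k K from χ))
    rw [hr] at this
    exact this

/-- If `R` has injective dimension at most one as a right module, then the dual of the right
module `R` has projective dimension at most one: the dual of `0 → K → P → D R → 0` is a
coresolution `0 → R → D P → D K → 0` with `D P` injective. -/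
theorem projective_of_exact_unopDual [Module.Finite k R]
    (hR : HasInjectiveDimensionLE (ModuleCat.of Rᵐᵒᵖ R) 1)
    {K P : Type u} [AddCommGroup K] [Module k K] [Module R K]
    [IsScalarTower k R K] [AddCommGroup P] [Module k P] [Module R P] [IsScalarTower k R P]
    [Module.Finite R P]
    [Module.Projective R P] (i : K →ₗ[R] P) (p : P →ₗ[R] UnopDual k R)
    (hi : Function.Injective i) (hp : Function.Surjective p) (h : Function.Exact i p) :
    Module.Projective R K := by
  have := IsNoetherianRing.of_finite k R
  have : Module.Finite R K := Module.Finite.of_injective i hi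
  have := injective_opDual (k := k) (R := R) P
  have := Module.Finite.trans (R := k) R P
  let j : R →ₗ[Rᵐᵒᵖ] OpDual k P :=
    { toFun a := LinearMap.applyₗ (M := R) (M₂ := k) (R := k) a ∘ₗ p.restrictScalars k
      map_add' a b := OpDual.ext fun x => map_add (p x) a b
      map_smul' a b := OpDual.ext fun x => (DFunLike.congr_fun (p.map_smul a.unop x) b).symm }
  let S : ShortComplex (ModuleCat.{u} Rᵐᵒᵖ) := ShortComplex.mk
    (ModuleCat.ofHom j) (ModuleCat.ofHom (OpDual.map (k := k) i))
    (ModuleCat.hom_ext (LinearMap.ext fun a => OpDual.ext fun x => by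
      change p (i x) a = 0
      rw [h.apply_apply_eq_zero]
      rfl))
  have hS : S.ShortExact :=
    { mono_f := (ModuleCat.mono_iff_injective _).2 (by
        refine (injective_iff_map_eq_zero _).2 fun a ha => ?_
        rw [← Module.forall_dual_apply_eq_zero_iff k]
        intro χ
        obtain ⟨x, hx⟩ := hp χ
        have : p x a = 0 := DFunLike.congr_fun ha x
        rwa [hx] at this)
      epi_g := (ModuleCat.epi_iff_surjective _).2
        (LinearMap.dualMap_surjective_of_injective (f := i.restrictScalars k) hi)
      exact := (ShortComplex.moduleCat_exact_iff _).2 fun φ hφ => by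
        have hφ' : ∀ x, (show OpDual k P from φ) (i x) = 0 := fun x => DFunLike.congr_fun hφ x
        have hle : LinearMap.ker (p.restrictScalars k) ≤
            LinearMap.ker (show Module.Dual k P from φ) := fun x hx => by
          obtain ⟨y, rfl⟩ := (h x).1 hx
          exact hφ' y
        obtain ⟨ψ, hψ⟩ : ∃ ψ : Module.Dual k (UnopDual k R),
            ψ ∘ₗ p.restrictScalars k = (show Module.Dual k P from φ) := by
          have hmem : (show Module.Dual k P from φ) ∈
              (LinearMap.ker (p.restrictScalars k)).dualAnnihilator :=
            (Submodule.mem_dualAnnihilator _).2 fun x hx => hle hx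
          rw [← LinearMap.range_dualMap_eq_dualAnnihilator_ker] at hmem
          exact hmem
        refine ⟨(Module.evalEquiv k R).symm ψ, OpDual.ext fun x => ?_⟩
        refine (Module.apply_evalEquiv_symm_apply k R (show Module.Dual k R from p x) ψ).trans ?_
        exact LinearMap.congr_fun hψ x }
  have := hS.hasInjectiveDimensionLT_X₃ 1 inferInstance hR
  have : Injective (ModuleCat.of Rᵐᵒᵖ (OpDual k K)) :=
    injective_iff_hasInjectiveDimensionLT_one.2 this
  exact projective_of_injective_opDual (k := k)

end

/-! ### Modules over a ring of finite global dimension -/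

section RingGeneration

variable {R : Type u} [Ring R]

theorem shortExact_kernel_moduleCat {X Y : Type u} [AddCommGroup X] [Module R X] [AddCommGroup Y]
    [Module R Y] (g : X →ₗ[R] Y) (hg : Function.Surjective g) :
    (ShortComplex.mk (ModuleCat.ofHom (LinearMap.ker g).subtype) (ModuleCat.ofHom g)
      (ModuleCat.hom_ext (LinearMap.ext fun x => x.2))).ShortExact :=
  { mono_f := (ModuleCat.mono_iff_injective _).2 Subtype.val_injective
    epi_g := (ModuleCat.epi_iff_surjective _).2 hg
    exact := (ShortComplex.moduleCat_exact_iff _).2 fun x hx => ⟨⟨x, hx⟩, rfl⟩ }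

theorem shortExact_cokernel_moduleCat {X Y : Type u} [AddCommGroup X] [Module R X] [AddCommGroup Y]
    [Module R Y] (f : X →ₗ[R] Y) (hf : Function.Injective f) :
    (ShortComplex.mk (ModuleCat.ofHom f) (ModuleCat.ofHom (LinearMap.range f).mkQ)
      (ModuleCat.hom_ext (LinearMap.ext fun x =>
        (Submodule.Quotient.mk_eq_zero _).2 ⟨x, rfl⟩))).ShortExact :=
  { mono_f := (ModuleCat.mono_iff_injective _).2 hf
    epi_g := (ModuleCat.epi_iff_surjective _).2 (Submodule.mkQ_surjective _)
    exact := (ShortComplex.moduleCat_exact_iff _).2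
      fun _ hx => (Submodule.Quotient.mk_eq_zero _).1 hx }

variable {P : ObjectProperty (ModuleCat.{u} R)}

namespace CategoryTheory.ObjectProperty.IsThickInAbelian

/-- Finite powers of `E` are iterated extensions of copies of `E`. -/
theorem prop_pow_of_retract_of_extension
    (hr : ∀ {X Y : ModuleCat.{u} R}, Retract X Y → P Y → P X)
    (he : ∀ {S : ShortComplex (ModuleCat.{u} R)}, S.ShortExact → P S.X₁ → P S.X₃ → P S.X₂)
    {E : Type u} [AddCommGroup E] [Module R E] (hE : P (ModuleCat.of R E)) (n : ℕ) :
    P (ModuleCat.of R (Fin n → E)) := by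
  induction n with
  | zero =>
    exact hr (Y := ModuleCat.of R E)
      { i := 0, r := 0, retract := (ModuleCat.isZero_of_subsingleton _).eq_of_src _ _ } hE
  | succ n ih =>
    refine he (shortExact_kernel_moduleCat
      (LinearMap.funLeft R E (Fin.succ (n := n)))
      (LinearMap.funLeft_surjective_of_injective _ _ _ (Fin.succ_injective n))) ?_ ih
    let e : E →ₗ[R] LinearMap.ker (LinearMap.funLeft R E (Fin.succ (n := n))) :=
      (LinearMap.single R (fun _ : Fin (n + 1) => E) 0).codRestrict _ fun x => by
        ext i
        simp [LinearMap.funLeft_apply]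
    refine hr (Y := ModuleCat.of R E)
      { i := ModuleCat.ofHom (LinearMap.proj 0 ∘ₗ Submodule.subtype _)
        r := ModuleCat.ofHom e
        retract := ModuleCat.hom_ext (LinearMap.ext fun x => Subtype.ext (funext fun i => ?_)) } hE
    refine Fin.cases ?_ (fun i => ?_) i
    · exact Pi.single_eq_same (M := fun _ : Fin (n + 1) => E) 0 _
    · have := congrFun x.2 i
      simp [e]
      exact this.symm

theorem of_pow (hP : P.IsThickInAbelian) {E : Type u}
    [AddCommGroup E] [Module R E] (hE : P (ModuleCat.of R E)) (n : ℕ) :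
    P (ModuleCat.of R (Fin n → E)) :=
  prop_pow_of_retract_of_extension hP.of_retract hP.of_shortExact₂ hE n

/-- Over a Noetherian ring of finite global dimension, every finitely generated module is in the
thick class generated by the regular module. -/
theorem of_hasFiniteGlobalDimension (hP : P.IsThickInAbelian) [IsNoetherianRing R]
    (hR : P (ModuleCat.of R R))
    (hdim : HasFiniteGlobalDimension R) (V : ModuleCat.{u} R) [Module.Finite R V] : P V := by
  obtain ⟨d, hd⟩ := hdim
  replace hd := hd V
  induction d generalizing V with
  | zero =>
    obtain ⟨n, π, hπ⟩ := Module.Finite.exists_fin' R V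
    have : Projective V := projective_iff_hasProjectiveDimensionLT_one.2 hd
    have : Epi (ModuleCat.ofHom π) := (ModuleCat.epi_iff_surjective _).2 hπ
    exact hP.of_retract { i := Projective.factorThru (𝟙 V) (ModuleCat.ofHom π),
                          r := ModuleCat.ofHom π,
                          retract := Projective.factorThru_comp _ _ } (hP.of_pow hR n)
  | succ d ih =>
    obtain ⟨n, π, hπ⟩ := Module.Finite.exists_fin' R V
    have hS := shortExact_kernel_moduleCat π hπ
    have hproj : Projective (ModuleCat.of R (Fin n → R)) :=
      (IsProjective.iff_projective _).1 inferInstance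
    exact hP.of_shortExact₃ hS
      (ih (ModuleCat.of R (LinearMap.ker π))
        ((hS.hasProjectiveDimensionLT_X₃_iff d hproj).1 hd)) (hP.of_pow hR n)

/-- Over a finite-dimensional algebra of finite global dimension, every finitely generated module
is in the thick class generated by the dual of the regular right module. -/
theorem of_hasFiniteGlobalDimension_of_unopDual {k : Type u} [Field k] [Algebra k R]
    [Module.Finite k R]
    (hP : P.IsThickInAbelian) (hR : P (ModuleCat.of R (UnopDual k R)))
    (hdim : HasFiniteGlobalDimension R) (V : ModuleCat.{u} R) [Module.Finite R V] : P V := by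
  obtain ⟨d, hd⟩ := hdim
  replace hd : HasInjectiveDimensionLE V d := by
    let := HasExt.standard (ModuleCat.{u} R)
    refine HasInjectiveDimensionLT.mk fun i hi Y e => ?_
    have := hd Y
    exact Abelian.Ext.eq_zero_of_hasProjectiveDimensionLT e (d + 1) hi
  have hfin : Module.Finite R (UnopDual k R) := Module.Finite.of_restrictScalars_finite k R _
  -- `V` embeds into a power of the dual, by `v ↦ (r ↦ bᵢ (r • v))` for the coordinates `bᵢ` of `V`
  have hemb : ∀ (V : ModuleCat.{u} R) [Module.Finite R V], ∃ (n : ℕ)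
      (f : V →ₗ[R] (Fin n → UnopDual k R)), Function.Injective f := by
    intro V _
    let : Module k V := Module.compHom V (algebraMap k R)
    have : IsScalarTower k R V := IsScalarTower.of_algebraMap_smul fun _ _ => rfl
    have := Module.Finite.trans (R := k) R V
    let b := Module.finBasis k V
    refine ⟨_, LinearMap.pi fun i =>
      { toFun v := b.coord i ∘ₗ (LinearMap.toSpanSingleton R V v).restrictScalars k
        map_add' v v' := UnopDual.ext fun r => by
          change b.coord i (r • (v + v')) = b.coord i (r • v) + b.coord i (r • v')
          rw [smul_add, map_add]
        map_smul' a v := UnopDual.ext fun r => congrArg (b.coord i) (mul_smul r a v).symm },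
      (injective_iff_map_eq_zero _).2 fun v hv => b.ext_elem fun i => ?_⟩
    have h : b.coord i ((1 : R) • v) = 0 := DFunLike.congr_fun (congrFun hv i) (1 : R)
    rw [one_smul] at h
    simpa using h
  have hinj : ∀ n, Injective (ModuleCat.of R (Fin n → UnopDual k R)) := fun n => by
    have := injective_unopDual_self k R
    exact injective_iff_hasInjectiveDimensionLT_one.2 (prop_pow_of_retract_of_extension
      (P := fun X : ModuleCat.{u} R => HasInjectiveDimensionLT X 1)
      (fun r _ => r.hasInjectiveDimensionLT 1)
      (fun hS h₁ h₃ => hS.hasInjectiveDimensionLT_X₂ 1 h₁ h₃) inferInstance n)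
  induction d generalizing V with
  | zero =>
    obtain ⟨n, f, hf⟩ := hemb V
    have : Injective V := injective_iff_hasInjectiveDimensionLT_one.2 hd
    have : Mono (ModuleCat.ofHom f) := (ModuleCat.mono_iff_injective _).2 hf
    exact hP.of_retract { i := ModuleCat.ofHom f,
                          r := Injective.factorThru (𝟙 V) (ModuleCat.ofHom f),
                          retract := Injective.comp_factorThru _ _ } (hP.of_pow hR n)
  | succ d ih =>
    obtain ⟨n, f, hf⟩ := hemb V
    have hS := shortExact_cokernel_moduleCat f hf
    exact hP.of_shortExact₁ hS (hP.of_pow hR n)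
      (ih (ModuleCat.of R ((Fin n → UnopDual k R) ⧸ LinearMap.range f))
        ((hS.hasInjectiveDimensionLT_X₃_iff d (hinj n)).2 hd))

end CategoryTheory.ObjectProperty.IsThickInAbelian

end RingGeneration

/-! ### Graded modules concentrated in one degree -/

namespace GrMod

variable {k A : Type u} [Field k] [Ring A] [Algebra k A] {𝒜 : ℤ → Submodule k A}
  [GradedAlgebra 𝒜]

section ConcentratedModules

/-- The projection `A → A₀` of a positively graded algebra. -/
def projZero (hpos : ∀ i < 0, 𝒜 i = ⊥) : A →+* 𝒜 0 where
  toFun a := DirectSum.decompose 𝒜 a 0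
  map_one' := Subtype.ext (DirectSum.decompose_of_mem_same 𝒜 SetLike.GradedOne.one_mem)
  map_zero' := by simp
  map_add' a b := by simp
  map_mul' a b := by
    have hzero : ∀ {i : ℤ} {x : A}, x ∈ 𝒜 i → i ≠ 0 → DirectSum.decompose 𝒜 x 0 = 0 :=
      fun hx hi => Subtype.ext (DirectSum.decompose_of_mem_ne 𝒜 hx hi)
    have hneg : ∀ {i : ℤ} {x : A}, x ∈ 𝒜 i → i < 0 → x = 0 := fun hx hi => by
      rw [hpos _ hi] at hx
      exact hx
    induction a using DirectSum.Decomposition.inductionOn 𝒜 with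
    | zero => simp
    | add a a' ha ha' => rw [add_mul, DirectSum.decompose_add, DirectSum.decompose_add,
        DirectSum.add_apply, DirectSum.add_apply, ha, ha', add_mul]
    | homogeneous a =>
      rename_i i
      induction b using DirectSum.Decomposition.inductionOn 𝒜 with
      | zero => simp
      | add b b' hb hb' => rw [mul_add, DirectSum.decompose_add, DirectSum.decompose_add,
          DirectSum.add_apply, DirectSum.add_apply, hb, hb', mul_add]
      | homogeneous b =>
        rename_i j
        by_cases hi : i < 0
        · rw [hneg a.2 hi]
          simp
        by_cases hj : j < 0
        · rw [hneg b.2 hj]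
          simp
        have hab : (a : A) * b ∈ 𝒜 (i + j) := SetLike.mul_mem_graded a.2 b.2
        by_cases hi0 : i = 0
        · by_cases hj0 : j = 0
          · subst hi0 hj0
            refine Subtype.ext ?_
            rw [DirectSum.decompose_of_mem_same 𝒜 (by simpa using hab), SetLike.GradeZero.coe_mul,
              DirectSum.decompose_of_mem_same 𝒜 a.2, DirectSum.decompose_of_mem_same 𝒜 b.2]
          · rw [hzero hab (by lia), hzero b.2 hj0, mul_zero]
        · rw [hzero hab (by lia), hzero a.2 hi0, zero_mul]

variable (hpos : ∀ i < 0, 𝒜 i = ⊥)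

theorem projZero_coe (a : 𝒜 0) : projZero hpos (a : A) = a :=
  Subtype.ext (DirectSum.decompose_of_mem_same 𝒜 a.2)

theorem projZero_eq_zero {i : ℤ} {a : A} (ha : a ∈ 𝒜 i) (hi : i ≠ 0) : projZero hpos a = 0 :=
  Subtype.ext (DirectSum.decompose_of_mem_ne 𝒜 ha hi)

/-- An `A₀`-module `V`, as a graded `A`-module concentrated in degree `j`. -/
def inDeg (j : ℤ) (V : Type u) [AddCommGroup V] [Module (𝒜 0) V] [Module.Finite (𝒜 0) V] :
    GrMod 𝒜 where
  carrier := V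
  module := Module.compHom V (projZero hpos)
  finite :=
    letI : Module A V := Module.compHom V (projZero hpos)
    letI : SMul (𝒜 0) A := ⟨fun r a => (r : A) * a⟩
    have : IsScalarTower (𝒜 0) A V := ⟨fun r a v => by
      change projZero hpos ((r : A) * a) • v = r • projZero hpos a • v
      rw [map_mul, projZero_coe, mul_smul]⟩
    Module.Finite.of_restrictScalars_finite (𝒜 0) A V
  deg i := if i = j then ⊤ else ⊥
  isInternal := by
    refine IntGrading.isInternal_of_comp (fun i => if i = j then AddMonoidHom.id V else 0) ?_ ?_ ?_
    · intro i x hx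
      split_ifs at hx ⊢ with h
      · rfl
      · exact hx.symm
    · intro i l hil x hx
      split_ifs at hx ⊢ with h h'
      · exact absurd (h'.trans h.symm) hil
      · rw [AddSubgroup.mem_bot.1 hx, map_zero]
      · rfl
      · rfl
    · intro x
      exact AddSubgroup.mem_iSup_of_mem j (by rw [if_pos rfl]; trivial)
  gradedSMul :=
    letI : Module A V := Module.compHom V (projZero hpos)
    ⟨fun {i l a x} ha hx => by
      change projZero hpos a • x ∈ (if i + l = j then ⊤ else ⊥ : AddSubgroup V)
      split_ifs at hx ⊢ with h h' h'
      · trivial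
      · trivial
      · rw [projZero_eq_zero hpos ha (by lia)]
        exact zero_smul (𝒜 0) x
      · rw [AddSubgroup.mem_bot.1 hx, smul_zero]
        exact zero_mem _⟩

section

variable {j : ℤ} {V : Type u} [AddCommGroup V] [Module (𝒜 0) V] [Module.Finite (𝒜 0) V]

theorem mem_inDeg_deg (v : V) : v ∈ (inDeg hpos j V).deg j := by
  change v ∈ (if j = j then ⊤ else ⊥ : AddSubgroup V)
  rw [if_pos rfl]
  trivial

theorem inDeg_deg_eq_bot {i : ℤ} (hi : i ≠ j) : (inDeg hpos j V).deg i = ⊥ := if_neg hi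

/-- A morphism from an `A₀`-module placed in degree `j`, given by an additive map into the
component of degree `j` on which `A` acts through `A₀`. -/
def fromInDeg {X : GrMod 𝒜} (f : V →+ X) (hf : ∀ v, f v ∈ X.deg j)
    (h : ∀ (a : A) (v : V), f (projZero hpos a • v) = a • f v) : inDeg hpos j V ⟶ X :=
  mkHom { f with map_smul' := h } fun i v hv => by
    by_cases hi : i = j
    · exact hi ▸ hf v
    · rw [inDeg_deg_eq_bot hpos hi] at hv
      have : f v = 0 := by
        rw [AddSubgroup.mem_bot.1 hv]
        exact map_zero f
      exact this ▸ zero_mem _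

end

/-- Functoriality of `inDeg` in the `A₀`-module. -/
def inDegMap (j : ℤ) {V W : Type u} [AddCommGroup V] [Module (𝒜 0) V] [Module.Finite (𝒜 0) V]
    [AddCommGroup W] [Module (𝒜 0) W] [Module.Finite (𝒜 0) W] (f : V →ₗ[𝒜 0] W) :
    inDeg hpos j V ⟶ inDeg hpos j W :=
  fromInDeg hpos (X := inDeg hpos j W) f.toAddMonoidHom (fun v => mem_inDeg_deg hpos (f v))
    fun a v => f.map_smul (projZero hpos a) v

variable [Module.Finite k A]

variable (𝒜) in
/-- The module structure of `A₀` over `k` is here the one given by the algebra structure of `A₀`,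
rather than the one of a submodule of `A`: these are not reducibly equal. -/
theorem finite_zero : @Module.Finite k (𝒜 0) _ _ Algebra.toModule :=
  inferInstanceAs (Module.Finite k (𝒜 0 : Submodule k A))

variable (𝒜) in
theorem isNoetherianRing_zero : IsNoetherianRing (𝒜 0) :=
  @IsNoetherianRing.of_finite k (𝒜 0) _ _ Algebra.toModule
    (@IsScalarTower.right k (𝒜 0) _ _ _) inferInstance (finite_zero 𝒜)

/-- The finitely generated `A₀`-modules which are in `G` when placed in degree `j`. -/
def concentrated (G : ObjectProperty (GrMod 𝒜)) (j : ℤ) : ObjectProperty (ModuleCat.{u} (𝒜 0)) :=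
  fun V => ∃ _ : Module.Finite (𝒜 0) V, G (inDeg hpos j V)

theorem isThickInAbelian_concentrated {G : ObjectProperty (GrMod 𝒜)} (hG : G.IsThickInAbelian)
    (j : ℤ) : (concentrated hpos G j).IsThickInAbelian := by
  have := isNoetherianRing_zero 𝒜
  have hex : ∀ (S : ShortComplex (ModuleCat.{u} (𝒜 0))) [Module.Finite (𝒜 0) S.X₁]
      [Module.Finite (𝒜 0) S.X₂] [Module.Finite (𝒜 0) S.X₃], S.ShortExact →
      ∃ w, (ShortComplex.mk (inDegMap hpos j S.f.hom) (inDegMap hpos j S.g.hom) w).ShortExact := by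
    intro S _ _ _ hS
    exact ⟨hom_ext (LinearMap.ext fun x =>
        LinearMap.congr_fun (congrArg ModuleCat.Hom.hom S.zero) x),
      shortExact_of_exact ((ModuleCat.mono_iff_injective _).1 hS.mono_f)
      ((ModuleCat.epi_iff_surjective _).1 hS.epi_g)
      ((ShortComplex.moduleCat_exact_iff _).1 hS.exact)⟩
  have hfin₁ : ∀ {S : ShortComplex (ModuleCat.{u} (𝒜 0))}, S.ShortExact →
      Module.Finite (𝒜 0) S.X₂ → Module.Finite (𝒜 0) S.X₁ := fun hS _ =>
    Module.Finite.of_injective _ ((ModuleCat.mono_iff_injective _).1 hS.mono_f)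
  have hfin₃ : ∀ {S : ShortComplex (ModuleCat.{u} (𝒜 0))}, S.ShortExact →
      Module.Finite (𝒜 0) S.X₂ → Module.Finite (𝒜 0) S.X₃ := fun hS _ =>
    Module.Finite.of_surjective _ ((ModuleCat.epi_iff_surjective _).1 hS.epi_g)
  constructor
  · rintro V W r ⟨_, hW⟩
    have hr : r.r.hom ∘ₗ r.i.hom = LinearMap.id := congrArg ModuleCat.Hom.hom r.retract
    have : Module.Finite (𝒜 0) V := Module.Finite.of_surjective r.r.hom
      fun v => ⟨r.i.hom v, LinearMap.congr_fun hr v⟩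
    exact ⟨this, hG.of_retract
      { i := inDegMap hpos j r.i.hom
        r := inDegMap hpos j r.r.hom
        retract := hom_ext (LinearMap.ext fun v => LinearMap.congr_fun hr v) } hW⟩
  · rintro S hS ⟨_, h₂⟩ ⟨_, h₃⟩
    have := hfin₁ hS inferInstance
    obtain ⟨w, h⟩ := hex S hS
    exact ⟨this, hG.of_shortExact₁ h h₂ h₃⟩
  · rintro S hS ⟨_, h₁⟩ ⟨_, h₃⟩
    have : Module.Finite (𝒜 0) S.X₂ := by
      obtain ⟨hf, hg⟩ := (⟨hS.exact, hS.epi_g⟩ : S.Exact ∧ Epi S.g)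
      exact Module.Finite.of_exact
        ((ShortComplex.ShortExact.moduleCat_exact_iff_function_exact S).1 hf)
        ((ModuleCat.epi_iff_surjective _).1 hg)
    obtain ⟨w, h⟩ := hex S hS
    exact ⟨this, hG.of_shortExact₂ h h₁ h₃⟩
  · rintro S hS ⟨_, h₁⟩ ⟨_, h₂⟩
    have := hfin₃ hS inferInstance
    obtain ⟨w, h⟩ := hex S hS
    exact ⟨this, hG.of_shortExact₃ h h₁ h₂⟩

end ConcentratedModules

section Filtration

/-- The component of degree `j` of a graded module, as an `A₀`-module. -/
def piece (X : GrMod 𝒜) (j : ℤ) : Type u := X.deg j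

instance (X : GrMod 𝒜) (j : ℤ) : AddCommGroup (X.piece j) :=
  inferInstanceAs (AddCommGroup (X.deg j))

instance (X : GrMod 𝒜) (j : ℤ) : Module (𝒜 0) (X.piece j) where
  smul r x := ⟨(r : A) • x.1, by
    have := SetLike.GradedSMul.smul_mem (A := 𝒜) (B := X.deg) r.2 x.2
    rwa [zero_vadd] at this⟩
  one_smul x := Subtype.ext (one_smul A x.1)
  mul_smul r s x := Subtype.ext (mul_smul (r : A) (s : A) x.1)
  smul_zero r := Subtype.ext (smul_zero (r : A))
  smul_add r x y := Subtype.ext (smul_add (r : A) x.1 y.1)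
  add_smul r s x := Subtype.ext (add_smul (r : A) (s : A) x.1)
  zero_smul x := Subtype.ext (zero_smul A x.1)

variable [Module.Finite k A]

instance (X : GrMod 𝒜) (j : ℤ) : Module.Finite (𝒜 0) (X.piece j) := by
  let := X.moduleBase
  have := X.finite_base
  let : Module k (X.piece j) := inferInstanceAs (Module k (X.degSubmodule j))
  have : Module.Finite k (X.piece j) := inferInstanceAs (Module.Finite k (X.degSubmodule j))
  have : @IsScalarTower k (𝒜 0) (X.piece j) Algebra.toSMul _ _ :=
    IsScalarTower.of_algebraMap_smul fun c x => rfl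
  exact Module.Finite.of_restrictScalars_finite k (𝒜 0) (X.piece j)

variable (hpos : ∀ i < 0, 𝒜 i = ⊥)

omit [Module.Finite k A] in
/-- On the component of highest degree of a graded module, `A` acts through `A₀`. -/
theorem projZero_smul_of_top (X : GrMod 𝒜) (j : ℤ) (hX : ∀ i, j < i → X.deg i = ⊥) (a : A)
    (x : X) (hx : x ∈ X.deg j) : (projZero hpos a : A) • x = a • x := by
  induction a using DirectSum.Decomposition.inductionOn 𝒜 with
  | zero => simp
  | add a b ha hb => rw [map_add, Submodule.coe_add, add_smul, ha, hb, add_smul]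
  | homogeneous a =>
    rename_i i
    by_cases hi : i = 0
    · subst hi
      rw [projZero_coe]
    · rw [projZero_eq_zero hpos a.2 hi]
      have h : (a : A) • x ∈ X.deg (i + j) :=
        SetLike.GradedSMul.smul_mem (A := 𝒜) (B := X.deg) a.2 hx
      have h0 : (a : A) • x = 0 := by
        by_cases hi' : i < 0
        · have ha : (a : A) = 0 := (Submodule.mem_bot k).1 ((hpos i hi').le a.2)
          rw [ha, zero_smul]
        · rw [hX _ (by lia)] at h
          exact h
      rw [h0]
      exact zero_smul A x

/-- A graded module in degrees `a, …, b` is in a thick class `G` if all modules concentrated in one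
of these degrees are: its component of degree `b` is a submodule. -/
theorem prop_of_concentrated {G : ObjectProperty (GrMod 𝒜)} (hG : G.IsThickInAbelian)
    (hG₀ : ∀ X, IsZero X → G X) (a b : ℤ)
    (h : ∀ j, a ≤ j → j ≤ b → ∀ V : ModuleCat.{u} (𝒜 0), Module.Finite (𝒜 0) V →
      concentrated hpos G j V)
    (X : GrMod 𝒜) (ha : ∀ i < a, X.deg i = ⊥) (hb : ∀ i, b < i → X.deg i = ⊥) : G X := by
  obtain ⟨d, hd⟩ : ∃ d : ℕ, b + 1 - a ≤ d := ⟨(b + 1 - a).toNat, by simp⟩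
  induction d generalizing X b with
  | zero =>
    refine hG₀ X (X.isZero_of_deg_eq_bot fun i => ?_)
    by_cases hi : i < a
    · exact ha i hi
    · exact hb i (by push_cast at hd; lia)
  | succ d ih =>
    by_cases hab : b < a
    · exact ih b h X ha hb (by lia)
    let f : inDeg hpos b (X.piece b) ⟶ X := fromInDeg hpos (X.deg b).subtype (fun v => v.2)
      fun r v => X.projZero_smul_of_top hpos b hb r v.1 v.2
    have hf : Function.Injective (lin f) := Subtype.val_injective
    refine hG.of_shortExact₂ (shortExact_cokernel f hf)
      (h b (by lia) le_rfl (ModuleCat.of _ (X.piece b)) inferInstance).choose_spec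
      (ih (b - 1) (fun j hj hj' => h j hj (by lia)) _ (fun i hi => ?_) (fun i hi => ?_)
        (by push_cast at hd; lia))
    · refine deg_quot_eq_bot (range_isHomog f) fun x hx => ?_
      rw [ha i hi] at hx
      rw [AddSubgroup.mem_bot.1 hx]
      exact zero_mem _
    · refine deg_quot_eq_bot (range_isHomog f) fun x hx => ?_
      by_cases hib : i = b
      · subst hib
        exact ⟨⟨x, hx⟩, rfl⟩
      · rw [hb i (by lia)] at hx
        rw [AddSubgroup.mem_bot.1 hx]
        exact zero_mem _

end Filtration

end GrMod

/-! ### The dual of the regular module, and generation -/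

namespace GrMod

variable {k A : Type u} [Field k] [Ring A] [Algebra k A] {𝒜 : ℤ → Submodule k A}
  [GradedAlgebra 𝒜] [Module.Finite k A]

section DualRegular

variable (𝒜) in
/-- Almost all the projections of `A` onto its homogeneous components vanish, so that their sum
makes sense, and is the identity. -/
theorem exists_sum_proj : ∃ s : Finset ℤ, ∀ a : A, ∑ i ∈ s, GradedAlgebra.proj 𝒜 i a = a := by
  classical
  refine ⟨(finite_support (regular 𝒜)).toFinset, fun a => ?_⟩
  conv_rhs => rw [← DirectSum.sum_support_decompose 𝒜 a]
  refine (Finset.sum_subset (fun i hi => ?_) fun i _ hi => ?_).symm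
  · rw [Set.Finite.mem_toFinset]
    intro h
    have hmem : (DirectSum.decompose 𝒜 a i : A) ∈ (regular 𝒜).deg i :=
      SetLike.coe_mem (DirectSum.decompose 𝒜 a i)
    rw [h] at hmem
    exact DFinsupp.mem_support_iff.1 hi (Subtype.ext (AddSubgroup.mem_bot.1 hmem))
  · rw [DFinsupp.mem_support_iff, not_not] at hi
    rw [GradedAlgebra.proj_apply, hi]
    rfl

omit [Module.Finite k A] in
/-- A functional which vanishes on `𝒜 i` for `i ≠ n` factors through the projection to `𝒜 n`. -/
theorem apply_proj (φ : UnopDual k A) {n : ℤ} (hφ : ∀ i, i ≠ n → ∀ a ∈ 𝒜 i, φ a = 0) (a : A) :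
    φ (GradedAlgebra.proj 𝒜 n a) = φ a := by
  rw [GradedAlgebra.proj_apply]
  induction a using DirectSum.Decomposition.inductionOn 𝒜 with
  | zero => simp
  | add a b ha hb => rw [DirectSum.decompose_add, DirectSum.add_apply, Submodule.coe_add,
      map_add, map_add, ha, hb]
  | homogeneous a =>
    rename_i i
    by_cases hi : i = n
    · subst hi
      rw [DirectSum.decompose_of_mem_same 𝒜 a.2]
    · rw [DirectSum.decompose_of_mem_ne 𝒜 a.2 hi, hφ i hi _ a.2, map_zero]

variable (𝒜) in
/-- The dual `D A = Hom_k(A, k)` of the regular right module, as a graded left module; its component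
of degree `n` consists of the functionals which vanish on `𝒜 i` for all `i ≠ -n`. -/
noncomputable def dualRegular : GrMod 𝒜 where
  carrier := UnopDual k A
  finite := Module.Finite.of_restrictScalars_finite k A (UnopDual k A)
  deg n :=
    { carrier := {φ | ∀ i, i ≠ -n → ∀ a ∈ 𝒜 i, φ a = 0}
      zero_mem' := fun _ _ _ _ => rfl
      add_mem' := fun {φ ψ} hφ hψ i hi a ha =>
        (congrArg₂ (· + ·) (hφ i hi a ha) (hψ i hi a ha)).trans (add_zero 0)
      neg_mem' := fun {φ} hφ i hi a ha => (congrArg (- ·) (hφ i hi a ha)).trans neg_zero }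
  isInternal := by
    refine IntGrading.isInternal_of_comp (fun n =>
      { toFun := fun φ => (show Module.Dual k A from φ) ∘ₗ GradedAlgebra.proj 𝒜 (-n)
        map_zero' := rfl
        map_add' := fun _ _ => rfl }) ?_ ?_ ?_
    · intro n φ hφ
      exact UnopDual.ext fun a => apply_proj φ hφ a
    · intro n m hnm φ hφ
      refine UnopDual.ext fun a => ?_
      exact hφ (-m) (by lia) _ (SetLike.coe_mem _)
    · intro φ
      obtain ⟨s, hs⟩ := exists_sum_proj 𝒜
      have : φ = ∑ i ∈ s, (show UnopDual k A from
          (show Module.Dual k A from φ) ∘ₗ GradedAlgebra.proj 𝒜 i) := by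
        refine UnopDual.ext fun a => ?_
        refine Eq.trans ?_ (LinearMap.sum_apply s (fun i =>
          (show Module.Dual k A from φ) ∘ₗ GradedAlgebra.proj 𝒜 i) a).symm
        conv_lhs => rw [← hs a, map_sum]
        rfl
      rw [this]
      refine sum_mem fun i _ => AddSubgroup.mem_iSup_of_mem (-i) fun j hj a ha => ?_
      change φ (GradedAlgebra.proj 𝒜 i a) = 0
      rw [GradedAlgebra.proj_apply, DirectSum.decompose_of_mem_ne 𝒜 ha (by lia), map_zero]
  gradedSMul := ⟨fun {i j a φ} ha hφ l hl b hb =>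
    hφ (l + i) (by rw [vadd_eq_add] at hl; lia) (b * a) (SetLike.mul_mem_graded hb ha)⟩

theorem dualRegular_deg_eq_bot (hpos : ∀ i < 0, 𝒜 i = ⊥) {n : ℤ} (hn : 0 < n) :
    (dualRegular 𝒜).deg n = ⊥ := by
  refine (AddSubgroup.eq_bot_iff_forall _).2 fun (φ : UnopDual k A) hφ => UnopDual.ext fun a => ?_
  have h : GradedAlgebra.proj 𝒜 (-n) a = 0 :=
    (Submodule.mem_bot k).1 ((hpos _ (by lia)).le (SetLike.coe_mem _))
  refine (apply_proj φ hφ a).symm.trans ?_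
  rw [h, map_zero]
  rfl

/-- A thick class which contains the projectives contains the shifts of `D A`, as these have
projective dimension at most one. -/
theorem prop_dualRegular_shift {G : ObjectProperty (GrMod 𝒜)} (hG : G.IsThickInAbelian)
    (hproj : ∀ P, Projective P → G P) (hA : HasInjectiveDimensionLE (ModuleCat.of Aᵐᵒᵖ A) 1)
    (n : ℤ) : G ((dualRegular 𝒜).shift n) := by
  obtain ⟨P, p, hP, hp⟩ := exists_projective_surjection ((dualRegular 𝒜).shift n)
  let K := P.sub _ (ker_isHomog p)
  let i : K ⟶ P := P.subι _ (ker_isHomog p)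
  have : Module.Projective A K := by
    let := P.moduleBase
    have := P.isScalarTower_base
    let := K.moduleBase
    have := K.isScalarTower_base
    exact projective_of_exact_unopDual (k := k) (R := A) hA (lin i) (lin p) Subtype.val_injective hp
      fun x => ⟨fun hx => ⟨⟨x, hx⟩, rfl⟩, fun ⟨y, hy⟩ => hy ▸ y.2⟩
  exact hG.of_shortExact₃ (shortExact_kernel p hp) (hproj _ (projective_of_moduleProjective K))
    (hproj _ (projective_of_moduleProjective P))

end DualRegular

section Generation

variable (hpos : ∀ i < 0, 𝒜 i = ⊥)

omit [Module.Finite k A] in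
theorem truncLE_deg_eq_bot (X : GrMod 𝒜) {n i : ℤ} (h : n < i ∨ X.deg i = ⊥) :
    (X.truncLE n).deg i = ⊥ := by
  refine deg_quot_eq_bot _ fun x hx => ?_
  obtain h | h := h
  · exact Submodule.subset_span ⟨i, by lia, hx⟩
  · rw [h] at hx
    rw [AddSubgroup.mem_bot.1 hx]
    exact zero_mem _

/-- A thick class which contains the modules `A(i)_{≤ 0}` contains all modules concentrated in a
degree `≤ 0`. -/
theorem concentrated_neg {G : ObjectProperty (GrMod 𝒜)} (hG : G.IsThickInAbelian)
    (hG₀ : ∀ X, IsZero X → G X)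
    (hT : ∀ i : ℕ, G (((regular 𝒜).shift i).truncLE 0)) (hA₀ : HasFiniteGlobalDimension (𝒜 0))
    (n : ℕ) (V : ModuleCat.{u} (𝒜 0)) (hV : Module.Finite (𝒜 0) V) :
    concentrated hpos G (-n) V := by
  have := isNoetherianRing_zero 𝒜
  induction n using Nat.strong_induction_on generalizing V with
  | _ n ih =>
  refine (isThickInAbelian_concentrated hpos hG _).of_hasFiniteGlobalDimension
    ⟨inferInstance, ?_⟩ hA₀ V
  let X := (regular 𝒜).shift n
  -- `f` is the projection of `A(n)_{≤ 0}` onto its component of lowest degree `-n`, which is `A₀`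
  let π : X ⟶ inDeg hpos (-n) (𝒜 0) :=
    mkHom { toFun := projZero hpos
            map_add' := map_add _
            map_smul' := map_mul (projZero hpos) } fun i a ha => by
      by_cases hi : i = -n
      · subst hi
        exact mem_inDeg_deg hpos (projZero hpos a)
      · have h0 : projZero hpos a = 0 := projZero_eq_zero hpos ha (by lia)
        exact (show projZero hpos a ∈ (inDeg hpos (-n) (𝒜 0)).deg i from h0 ▸ zero_mem _)
  have hπ : X.geSubmodule (0 + 1) ≤ LinearMap.ker (lin π) := by
    refine Submodule.span_le.2 ?_
    rintro a ⟨i, hi, ha⟩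
    exact projZero_eq_zero hpos ha (by lia)
  let f : X.truncLE 0 ⟶ inDeg hpos (-n) (𝒜 0) := descQuot _ (X.geSubmodule_isHomog _) π hπ
  have hf : Function.Surjective (lin f) := fun a => ⟨Submodule.Quotient.mk (show 𝒜 0 from a).1,
    projZero_coe hpos a⟩
  refine hG.of_shortExact₃ (shortExact_kernel f hf) ?_ (hT n)
  refine prop_of_concentrated hpos hG hG₀ (-n + 1) 0 (fun j hj hj' W hW => ?_) _ (fun i hi => ?_)
    fun i hi => ?_
  · obtain ⟨m, rfl⟩ : ∃ m : ℕ, j = -m := ⟨j.natAbs, by lia⟩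
    exact ih m (by lia) W hW
  · refine deg_sub_eq_bot (ker_isHomog f) ?_
    rintro _ ⟨(a : A), (ha : a ∈ 𝒜 (n + i)), rfl⟩ ha'
    have ha' : projZero hpos a = 0 := ha'
    by_cases hi' : i = -n
    · subst hi'
      rw [add_neg_cancel] at ha
      have h0 : a = 0 :=
        (DirectSum.decompose_of_mem_same 𝒜 ha).symm.trans (congrArg Subtype.val ha')
      rw [h0]
      exact map_zero _
    · have h0 : X.deg i = ⊥ := deg_regular_shift_eq_bot hpos (by lia)
      have ha : a ∈ X.deg i := ha
      rw [h0] at ha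
      have h0 : a = 0 := ha
      rw [h0]
      exact map_zero _
  · refine deg_sub_eq_bot (ker_isHomog f) fun x hx _ => ?_
    rw [truncLE_deg_eq_bot X (.inl hi)] at hx
    exact hx

variable (𝒜) in
/-- The dual of `A₀` with respect to the module structure of `A₀` over `k` given by its algebra
structure, see `finite_zero`. -/
abbrev DualZero : Type u := @UnopDual k (𝒜 0) _ _ Algebra.toModule

/-- If the right module `A` has injective dimension at most one, a thick class which contains
the projectives and all modules concentrated in a degree `≤ 0` contains all modules
concentrated in a degree `≥ 0`. -/
theorem concentrated_pos {G : ObjectProperty (GrMod 𝒜)} (hG : G.IsThickInAbelian)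
    (hproj : ∀ P, Projective P → G P) (hA : HasInjectiveDimensionLE (ModuleCat.of Aᵐᵒᵖ A) 1)
    (hA₀ : HasFiniteGlobalDimension (𝒜 0))
    (hneg : ∀ (n : ℕ) (V : ModuleCat.{u} (𝒜 0)), Module.Finite (𝒜 0) V →
      concentrated hpos G (-n) V)
    (n : ℕ) (V : ModuleCat.{u} (𝒜 0)) (hV : Module.Finite (𝒜 0) V) :
    concentrated hpos G n V := by
  have hfin : @Module.Finite k (𝒜 0) _ _ Algebra.toModule := finite_zero 𝒜
  induction n using Nat.strong_induction_on generalizing V with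
  | _ n ih =>
  have : Module.Finite (𝒜 0) (DualZero 𝒜) :=
    @Module.Finite.of_restrictScalars_finite k (𝒜 0) (DualZero 𝒜) _ _ _ _ _ Algebra.toSMul _ _
  refine (isThickInAbelian_concentrated hpos hG _).of_hasFiniteGlobalDimension_of_unopDual (k := k)
    ⟨inferInstance, ?_⟩ hA₀ V
  let Y := (dualRegular 𝒜).shift (-n)
  let q : A →ₗ[k] 𝒜 0 :=
    { toFun := projZero hpos
      map_add' := map_add _
      map_smul' := fun c a => Subtype.ext
        (congrArg Subtype.val (congrArg (· 0) (DirectSum.decompose_smul 𝒜 c a))) }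
  -- `f` is the inclusion of the component of highest degree `n` of `D A(-n)`, which is `D A₀`
  let f : inDeg hpos n (DualZero 𝒜) ⟶ Y := fromInDeg hpos
    { toFun := fun φ => (show @Module.Dual k (𝒜 0) _ _ Algebra.toModule from φ) ∘ₗ q
      map_zero' := rfl
      map_add' := fun _ _ => rfl }
    (fun φ i hi a ha => by
      change φ (projZero hpos a) = 0
      rw [projZero_eq_zero hpos ha (by lia)]
      exact map_zero φ)
    (fun a φ => UnopDual.ext fun b => congrArg φ (map_mul (projZero hpos) b a).symm)
  have hf : Function.Injective (lin f) := fun (φ ψ : DualZero 𝒜) h => UnopDual.ext fun a => by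
    have h := DFunLike.congr_fun (show (show UnopDual k A from lin f φ) = lin f ψ from h) (a : A)
    have h : φ (projZero hpos a) = ψ (projZero hpos a) := h
    rwa [projZero_coe] at h
  refine hG.of_shortExact₁ (shortExact_cokernel f hf) (prop_dualRegular_shift hG hproj hA _) ?_
  obtain ⟨a, ha⟩ := exists_lower_bound (Y.quot _ (range_isHomog f))
  refine prop_of_concentrated hpos hG (fun X hX => hproj X hX.projective) a (n - 1)
    (fun j hj hj' W hW => ?_) _ ha fun i hi => deg_quot_eq_bot (range_isHomog f) fun φ hφ => ?_
  · by_cases hj : 0 ≤ j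
    · lift j to ℕ using hj
      exact ih j (by lia) W hW
    · obtain ⟨m, rfl⟩ : ∃ m : ℕ, j = -m := ⟨j.natAbs, by lia⟩
      exact hneg m W hW
  · by_cases hin : i = n
    · subst hin
      let ψ : @Module.Dual k (𝒜 0) _ _ Algebra.toModule :=
        (show Module.Dual k A from φ) ∘ₗ (𝒜 0).subtype
      refine ⟨(show DualZero 𝒜 from ψ), UnopDual.ext fun b => ?_⟩
      exact apply_proj (n := 0) (show UnopDual k A from φ) (fun i hi => hφ i (by lia)) b
    · have h0 : Y.deg i = ⊥ := dualRegular_deg_eq_bot hpos (by lia)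
      rw [h0] at hφ
      rw [AddSubgroup.mem_bot.1 hφ]
      exact zero_mem _

/-- For a `1`-Gorenstein algebra with `gl.dim A₀ < ∞`, a thick class of graded modules which
contains the projectives and the modules `A(i)_{≤ 0}` contains all graded modules. -/
theorem prop_of_isThickInAbelian {G : ObjectProperty (GrMod 𝒜)} (hG : G.IsThickInAbelian)
    (hproj : ∀ P, Projective P → G P) (hpos : ∀ i < 0, 𝒜 i = ⊥)
    (hA : HasInjectiveDimensionLE (ModuleCat.of Aᵐᵒᵖ A) 1)
    (hA₀ : HasFiniteGlobalDimension (𝒜 0))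
    (hT : ∀ i : ℕ, G (((regular 𝒜).shift i).truncLE 0)) (M : GrMod 𝒜) : G M := by
  have hG₀ : ∀ X, IsZero X → G X := fun X hX => hproj X hX.projective
  have hneg := concentrated_neg hpos hG hG₀ hT hA₀
  have hnn := concentrated_pos hpos hG hproj hA hA₀ hneg
  obtain ⟨a, ha⟩ := exists_lower_bound M
  obtain ⟨b, hb⟩ := exists_upper_bound M
  refine prop_of_concentrated hpos hG hG₀ a b (fun j _ _ V hV => ?_) M ha hb
  by_cases hj : 0 ≤ j
  · lift j to ℕ using hj
    exact hnn j V hV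
  · obtain ⟨m, rfl⟩ : ∃ m : ℕ, j = -m := ⟨j.natAbs, by lia⟩
    exact hneg m V hV

end Generation

end GrMod

/-! ### The silting object -/

open Abelian in
theorem DerivedCategory.hom_shift_eq_zero_of_ext {C : Type u'} [Category.{v} C] [Abelian C]
    [HasDerivedCategory.{w} C] [HasExt.{w} C] {X Y : C} (m : ℕ) (h : ∀ e : Ext X Y m, e = 0)
    (f : (singleFunctor C 0).obj X ⟶ ((singleFunctor C 0).obj Y)⟦(m : ℤ)⟧) : f = 0 := by
  obtain ⟨e, rfl⟩ := Ext.homAddEquiv.surjective f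
  rw [h e, map_zero]

namespace GrMod

variable {k A : Type u} [Field k] [Ring A] [Algebra k A] {𝒜 : ℤ → Submodule k A}
  [GradedAlgebra 𝒜] [Module.Finite k A]

theorem shiftTrunc_hom_shift_eq_zero (hpos : ∀ i < 0, 𝒜 i = ⊥)
    (hA : HasInjectiveDimensionLE (ModuleCat.of A A) 1) (i j : ℕ) (m : ℤ) (hm : 0 < m)
    (f : shiftTrunc 𝒜 i ⟶ (shiftTrunc 𝒜 j)⟦m⟧) : f = 0 := by
  let := HasExt.standard (GrMod 𝒜)
  refine SingularityCategory.stalk_hom_shift_eq_zero (fun P _ m hm f => ?_) (fun m hm f => ?_)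
    m hm f
  · have := hasInjectiveDimensionLT_two_of_projective hA P
    exact DerivedCategory.hom_shift_eq_zero_of_ext m
      (fun _ => Abelian.Ext.eq_zero_of_hasInjectiveDimensionLT _ 2 hm) f
  · exact DerivedCategory.hom_shift_eq_zero_of_ext m
      (fun e => ext_shiftTrunc_eq_zero hpos i j m hm e) f

variable (𝒜) in
/-- For large `i`, the module `A(i)` lives in degrees `≤ 0`, so
`A(i)_{≤ 0} = A(i)` is projective. -/
theorem exists_isZero_shiftTrunc : ∃ c : ℕ, ∀ i, c ≤ i → IsZero (shiftTrunc 𝒜 i) := by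
  obtain ⟨b, hb⟩ := exists_upper_bound (regular 𝒜)
  refine ⟨b.toNat, fun i hi => ?_⟩
  let X := (regular 𝒜).shift i
  have : Module.Projective A X := inferInstanceAs (Module.Projective A A)
  have hbot : X.geSubmodule (0 + 1) = ⊥ := by
    refine Submodule.span_eq_bot.2 fun x hx => ?_
    obtain ⟨j, hj, hx⟩ := hx
    have h0 : X.deg j = ⊥ := hb (i + j) (by lia)
    rw [h0] at hx
    exact hx
  have : Module.Projective A (X.truncLE 0) :=
    Module.Projective.of_equiv ((X.geSubmodule (0 + 1)).quotEquivOfEqBot hbot).symm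
  have := projective_of_moduleProjective (X.truncLE 0)
  exact SingularityCategory.isZero_stalk_of_projective (X.truncLE 0)

theorem eq_top_of_forall_shiftTrunc (hpos : ∀ i < 0, 𝒜 i = ⊥)
    (hA : HasInjectiveDimensionLE (ModuleCat.of Aᵐᵒᵖ A) 1)
    (hA₀ : HasFiniteGlobalDimension (𝒜 0)) (S : ObjectProperty (GradedSingularityCategory 𝒜))
    [S.IsTriangulated] [S.IsStableUnderRetracts] (hS : ∀ i, S (shiftTrunc 𝒜 i)) : S = ⊤ :=
  SingularityCategory.eq_top_of_forall_stalk S fun M =>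
    prop_of_isThickInAbelian (SingularityCategory.isThickInAbelian_stalk S)
      (fun P _ => S.prop_of_isZero (SingularityCategory.isZero_stalk_of_projective P))
      hpos hA hA₀ hS M

end GrMod

theorem theorem3p3 {k A : Type u} [Field k] [IsAlgClosed k] [Ring A] [Algebra k A]
    [Module.Finite k A] (𝒜 : ℤ → Submodule k A) [GradedAlgebra 𝒜]
    (hpos : ∀ i < 0, 𝒜 i = ⊥)
    (hA : IsGorensteinOfDimLE A 1)
    (hA₀ : HasFiniteGlobalDimension (𝒜 0)) :
    ∃ (T : GradedSingularityCategory 𝒜) (ι : ∀ i : ℕ, shiftTrunc 𝒜 i ⟶ T),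
      Nonempty (IsColimit (Cofan.mk T ι)) ∧ IsSilting T := by
  obtain ⟨c, hc⟩ := GrMod.exists_isZero_shiftTrunc 𝒜
  obtain ⟨ι, hι⟩ := exists_isColimit_cofan_of_isZero _ c hc
  refine ⟨_, ι, hι, isSilting_biproduct _
    (fun i j => GrMod.shiftTrunc_hom_shift_eq_zero hpos hA.1 i j) fun S _ _ h => ?_⟩
  refine GrMod.eq_top_of_forall_shiftTrunc hpos hA.2 hA₀ S fun i => ?_
  by_cases hi : i < c
  · exact h ⟨i, hi⟩
  · exact S.prop_of_isZero (hc i (by lia))
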